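/- Let $M$ be a closed (compact, without boundary) connected smooth manifold, and let $H:\mathbb{R}/\mathbb{Z}\times T^*M\to\mathbb{R}$ be a time-periodic Tonelli Hamiltonian: $H$ is $C^2$, $\partial_{pp}H(t,x,p)$ is positive definite everywhere, $|H(t,x,p)|/\|p\|\to\infty$ as $\|p\|\to\infty$ for each $(t,x)$, and the Hamiltonian flow of $H$ is complete. Let $L(t,x,v)=\max_{p\in T_x^*M}\{p(v)-H(t,x,p)\}$ be the associated Lagrangian. For $s<t$ and $c\in\mathbb{R}$ let $$h_c^{s,t}(x,y)=\inf_{\gamma}\int_s^t L(\tau,\gamma(\tau),\dot\gamma(\tau))\,d\tau+c\,(t-s),$$ where the infimum is over absolutely continuous curves $\gamma:[s,t]\to M$ with $\gamma(s)=x$, $\gamma(t)=y$, and let $h_c^{s,\infty+t}=\liminf_{n\to\infty}h_c^{s,n+t}$ ($n\in\mathbb{N}$) be the Peierls barrier. Let $\alpha_0\in\mathbb{R}$ be the Mañé critical value, that is, the threshold such that $h_c^{s,\infty+t}\equiv-\infty$ for all $s,t$ if $c<\alpha_0$ and $h_c^{s,\infty+t}\equiv+\infty$ for all $s,t$ if $c>\alpha_0$;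 explicitly, $\alpha_0=\sup\{c\in\mathbb{R}: h_c^{s,\infty+t}\equiv-\infty\text{ on }M\times M\text{ for all }s,t\in\mathbb{R}\}$. For $s<t$ and a continuous $u:M\to\mathbb{R}$, define the positive Lax–Oleinik operator $$T_+^{t,s}u(x)=\sup_{\gamma}\Big\{u(\gamma(t))-\int_s^tL(\tau,\gamma(\tau),\dot\gamma(\tau))\,d\tau\Big\}-\alpha_0\,(t-s),$$ where the supremum is over absolutely continuous curves $\gamma:[s,t]\to M$ with $\gamma(s)=x$. Then, for every $t\in\mathbb{R}$ and every continuous $u:M\to\mathbb{R}$, the family $(T_+^{t,s}u)_{s<t}$ is uniformly bounded in the sup norm: there is a constant $C$ (depending on $M$, $H$, $t$, $u$) such that, for all $s<t$ and $x\in M$, $T_+^{t,s}u(x)$ is finite and $|T_+^{t,s}u(x)|\le C$. -/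

import Mathlib

open scoped Manifold ContDiff Topology

noncomputable section

namespace WeakKAM

/-- The model space `ℝ^d`. -/
abbrev Model (d : ℕ) : Type := EuclideanSpace ℝ (Fin d)

/-- The dual of the model space, i.e. the model fibre of the cotangent bundle. -/
abbrev DualModel (d : ℕ) : Type := Model d →L[ℝ] ℝ

section Cotangent

variable (d : ℕ) (M : Type*) [TopologicalSpace M] [ChartedSpace (Model d) M]

/-- The cotangent space `T*_x M`, the dual of the tangent space. -/
abbrev CotangentSpace (x : M) : Type :=
  TangentSpace (𝓡 d) x →L[ℝ] Bundle.Trivial M ℝ x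

/-- The cotangent bundle `T*M`.  Mathlib's bundle of homomorphisms from the tangent bundle to the
trivial line bundle gives it its topology and its manifold structure; the chart of `T*M` at `z` is
`(q, p)`, where `q` is the preferred chart of `M` at the base point of `z` and `p` are the
coordinates of covectors with respect to `dq`. -/
abbrev CotangentBundle : Type _ :=
  Bundle.TotalSpace (DualModel d) (CotangentSpace d M)

/-- The model with corners (without boundary) of the manifold `T*M`. -/
abbrev cotangentModel : ModelWithCorners ℝ (Model d × DualModel d) (ModelProd (Model d) (DualModel d)) :=
  (𝓡 d).prod 𝓘(ℝ, DualModel d)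

end Cotangent

section Tonelli

variable {d : ℕ} {M : Type*} [TopologicalSpace M] [ChartedSpace (Model d) M]
  [IsManifold (𝓡 d) ∞ M]

/-- The canonical symplectic form `ω = dq ∧ dp = -d(p dq)` on `T_z(T*M)`, written in the canonical
coordinates `(q, p)` of `T*M` at `z` (Mathlib's `TangentSpace` at `z` is the model space
`ℝ^d × (ℝ^d)*` of that chart). -/
def symplecticForm (z : CotangentBundle d M) (X Y : TangentSpace (cotangentModel d) z) : ℝ :=
  let X' : Model d × DualModel d := X
  let Y' : Model d × DualModel d := Y
  Y'.2 X'.1 - X'.2 Y'.1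

/-- `X` is the value at `z` of the Hamiltonian vector field of `h : T*M → ℝ`: `ω(X, ·) = dh`. -/
def IsHamiltonianVector (h : CotangentBundle d M → ℝ) (z : CotangentBundle d M)
    (X : TangentSpace (cotangentModel d) z) : Prop :=
  ∀ Y : TangentSpace (cotangentModel d) z,
    symplecticForm z X Y =
      (mfderiv (cotangentModel d) 𝓘(ℝ, ℝ) h z Y : ℝ)

/-- `z : ℝ → T*M` is an orbit, defined for all times, of the time-dependent Hamiltonian `H`. -/
def IsHamiltonianOrbit (H : ℝ → CotangentBundle d M → ℝ) (z : ℝ → CotangentBundle d M) : Prop :=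
  ∀ t : ℝ, ∃ X : TangentSpace (cotangentModel d) (z t),
    IsHamiltonianVector (H t) (z t) X ∧
      HasMFDerivAt 𝓘(ℝ, ℝ) (cotangentModel d) z t ((1 : ℝ →L[ℝ] ℝ).smulRight X)

/-- Time-periodic Tonelli Hamiltonians `H : ℝ/ℤ × T*M → ℝ`, regarded as functions of
`(t, z) ∈ ℝ × T*M` that are `1`-periodic in `t`. -/
structure IsTonelli (H : ℝ → CotangentBundle d M → ℝ) : Prop where
  /-- `H` is `1`-periodic in time. -/
  periodic : ∀ t z, H (t + 1) z = H t z
  /-- `H` is of class `C²` on `ℝ × T*M`. -/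
  contMDiff : ContMDiff (𝓘(ℝ, ℝ).prod (cotangentModel d)) 𝓘(ℝ, ℝ) 2
    (fun w : ℝ × CotangentBundle d M => H w.1 w.2)
  /-- Strict convexity: the fibrewise Hessian `∂_pp H(t, x, p)` is positive definite. -/
  strictConvex : ∀ (t : ℝ) (x : M) (p η : CotangentSpace d M x), η ≠ 0 →
    0 < iteratedDeriv 2 (fun r : ℝ => H t ⟨x, p + r • η⟩) 0
  /-- Superlinearity on each fibre.  The fibre is finite-dimensional, so that the choice of its norm
  is immaterial; the norm of the model fibre is used. -/
  superlinear : ∀ (t : ℝ) (x : M),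
    Filter.Tendsto (fun p : DualModel d => |H t ⟨x, p⟩| / ‖p‖)
      (Bornology.cobounded (DualModel d)) Filter.atTop
  /-- Completeness of the Hamiltonian flow: every initial condition is on an orbit that is defined
  for all times. -/
  complete : ∀ (t₀ : ℝ) (z₀ : CotangentBundle d M),
    ∃ z : ℝ → CotangentBundle d M, z t₀ = z₀ ∧ IsHamiltonianOrbit H z

end Tonelli

section Action

variable {d : ℕ} {M : Type*} [TopologicalSpace M] [ChartedSpace (Model d) M]

/-- The Lagrangian `L(t, x, v) = max_p (p(v) - H(t, x, p))`, the convex conjugate of `H`. -/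
def lagrangian (H : ℝ → CotangentBundle d M → ℝ) (t : ℝ) (x : M) (v : TangentSpace (𝓡 d) x) : ℝ :=
  ⨆ p : CotangentSpace d M x, ((p v : ℝ) - H t ⟨x, p⟩)

/-- Absolutely continuous curves `γ : [s, t] → M` (values outside `[s, t]` are irrelevant): `γ` is
continuous, and absolutely continuous in charts. -/
def IsACCurve (d : ℕ) {M : Type*} [TopologicalSpace M] [ChartedSpace (Model d) M]
    (γ : ℝ → M) (s t : ℝ) : Prop :=
  ContinuousOn γ (Set.Icc s t) ∧
    ∀ (x : M) (a b : ℝ), s ≤ a → a ≤ b → b ≤ t →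
      (∀ τ ∈ Set.Icc a b, γ τ ∈ (chartAt (Model d) x).source) →
        AbsolutelyContinuousOnInterval (fun τ => extChartAt (𝓡 d) x (γ τ)) a b

/-- The velocity `γ'(τ)` of a curve. -/
def velocity (d : ℕ) {M : Type*} [TopologicalSpace M] [ChartedSpace (Model d) M]
    (γ : ℝ → M) (τ : ℝ) : TangentSpace (𝓡 d) (γ τ) :=
  mfderiv 𝓘(ℝ, ℝ) (𝓡 d) γ τ (1 : ℝ)

open Classical in
/-- The action `∫_s^t L(τ, γ(τ), γ'(τ)) dτ ∈ (-∞, +∞]`.  For a Tonelli Hamiltonian `L` is bounded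
below, so that the integral along an absolutely continuous curve is `+∞` when it is not finite. -/
def action (H : ℝ → CotangentBundle d M → ℝ) (γ : ℝ → M) (s t : ℝ) : EReal :=
  if IntervalIntegrable (fun τ => lagrangian H τ (γ τ) (velocity d γ τ)) MeasureTheory.volume s t
  then ((∫ τ in s..t, lagrangian H τ (γ τ) (velocity d γ τ) : ℝ) : EReal)
  else ⊤

/-- The potential `h_0^{s,t}(x, y)`: the infimum of the action over the absolutely continuous curves
`γ : [s, t] → M` with `γ(s) = x` and `γ(t) = y`. -/
def potential (H : ℝ → CotangentBundle d M → ℝ) (s t : ℝ) (x y : M) : EReal :=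
  ⨅ (γ : ℝ → M) (_ : IsACCurve d γ s t ∧ γ s = x ∧ γ t = y), action H γ s t

/-- The `(L + c)`-potential `h_c^{s,t}(x, y) = h_0^{s,t}(x, y) + c (t - s)`. -/
def potentialAt (H : ℝ → CotangentBundle d M → ℝ) (c s t : ℝ) (x y : M) : EReal :=
  potential H s t x y + ((c * (t - s) : ℝ) : EReal)

/-- The Peierls barrier `h_c^{s,∞+t}(x, y) = liminf_n h_c^{s,n+t}(x, y)`, with values in
`[-∞, +∞]`. -/
def peierlsBarrier (H : ℝ → CotangentBundle d M → ℝ) (c s t : ℝ) (x y : M) : EReal :=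
  Filter.liminf (fun n : ℕ => potentialAt H c s (n + t) x y) Filter.atTop

/-- The Mañé critical value `α₀`: the threshold of the constants `c` below which the Peierls barrier
is identically `-∞` (see `maneCriticalValue_eq`). -/
def maneCriticalValue (H : ℝ → CotangentBundle d M → ℝ) : ℝ :=
  sSup {c : ℝ | ∀ (s t : ℝ) (x y : M), peierlsBarrier H c s t x y = ⊥}

/-- The critical value is the constant `α` such that `h_c ≡ -∞` for `c < α` and `h_c ≡ +∞` for
`c > α`. -/
theorem maneCriticalValue_eq [Nonempty M] (H : ℝ → CotangentBundle d M → ℝ) (α : ℝ)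
    (hlt : ∀ c < α, ∀ (s t : ℝ) (x y : M), peierlsBarrier H c s t x y = ⊥)
    (hgt : ∀ c > α, ∀ (s t : ℝ) (x y : M), peierlsBarrier H c s t x y = ⊤) :
    maneCriticalValue H = α := by
  have hle : ∀ c ∈ {c : ℝ | ∀ (s t : ℝ) (x y : M), peierlsBarrier H c s t x y = ⊥}, c ≤ α := by
    intro c hc
    by_contra! h
    obtain ⟨x⟩ := ‹Nonempty M›
    have h1 := hc 0 0 x x
    rw [hgt c h 0 0 x x] at h1
    exact absurd h1 top_ne_bot
  refine le_antisymm (csSup_le ⟨α - 1, hlt _ (by linarith)⟩ hle) ?_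
  refine le_of_forall_lt fun c hc => ?_
  exact lt_of_lt_of_le (by linarith : c < (c + α) / 2)
    (le_csSup ⟨α, hle⟩ (hlt _ (by linarith)))

/-- The positive Lax–Oleinik operator `T_{+,0}^{t,s}`: the supremum of
`u(γ(t)) - ∫_s^t L(τ, γ(τ), γ'(τ)) dτ` over the absolutely continuous curves `γ : [s, t] → M` with
`γ(s) = x`. -/
def posLaxOleinikZero (H : ℝ → CotangentBundle d M → ℝ) (t s : ℝ) (u : M → ℝ) (x : M) : EReal :=
  ⨆ (γ : ℝ → M) (_ : IsACCurve d γ s t ∧ γ s = x), ((u (γ t) : EReal) - action H γ s t)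

/-- The full positive Lax–Oleinik operator `T_+^{t,s} u = T_{+,0}^{t,s} u - α₀ (t - s)`. -/
def posLaxOleinik (H : ℝ → CotangentBundle d M → ℝ) (t s : ℝ) (u : M → ℝ) (x : M) : EReal :=
  posLaxOleinikZero H t s u x - ((maneCriticalValue H * (t - s) : ℝ) : EReal)

/-- The operator in terms of the potential: `T_{+,0}^{t,s} u(x) = sup_y (u(y) - h_0^{s,t}(x, y))`. -/
theorem posLaxOleinikZero_eq (H : ℝ → CotangentBundle d M → ℝ) (t s : ℝ) (u : M → ℝ) (x : M) :
    posLaxOleinikZero H t s u x = ⨆ y : M, ((u y : EReal) - potential H s t x y) := by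
  have key : ∀ a : ℝ, ∀ b : EReal, ∀ c : EReal, (a : EReal) - b ≤ c ↔ (a : EReal) - c ≤ b := by
    intro a b c
    induction b <;> induction c <;> simp [← EReal.coe_sub, add_comm]
  apply le_antisymm
  · refine iSup₂_le fun γ hγ => ?_
    refine le_trans ?_ (le_iSup _ (γ t))
    refine EReal.sub_le_sub le_rfl ?_
    exact iInf₂_le γ ⟨hγ.1, hγ.2, rfl⟩
  · refine iSup_le fun y => ?_
    rw [key]
    refine le_iInf₂ fun γ hγ => ?_
    rw [key]
    obtain ⟨h1, h2, rfl⟩ := hγ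
    exact le_iSup₂ (f := fun (γ : ℝ → M) (_ : IsACCurve d γ s t ∧ γ s = x) =>
      ((u (γ t) : EReal) - action H γ s t)) γ ⟨h1, h2⟩

end Action

end WeakKAM

end

/-!
The proof compares all minimization problems through one relation: `WeakKAM.Reach H s t x y a` says
that `x` at time `s` is joined to `y` at time `t` by an absolutely continuous curve of action `a`.
Curves can be concatenated, cut, and translated by one period of `H`; the action over `[s, t]` is at
least `-K (t - s)`, because the Lagrangian is bounded below by minus the maximum of `H` on the zero
section; and any two points are joined in unit time with action at most `K`
(`WeakKAM.IsTonelli.exists_isTransitionCost`). No minimizers are needed.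

These facts alone force linear growth. The minimal action `m(s, t)` over all curves on `[s, t]`
satisfies `m(s, r) + m(r, t) ≤ m(s, t)`, as curves can be cut. The reverse inequality holds up to a
constant: between two almost minimal curves one inserts a connecting curve of unit duration,
translates the second curve by one period, and discards the last unit of time. With periodicity and
Fekete's lemma this gives a number `α` with `|m(s, t) + α (t - s)| ≤ C` for all `s ≤ t`, and by the
same device almost minimal curves start at every point, and join any two points if `t - s ≥ 1`
(`IsTransitionCost.exists_linear_growth`). Hence the potentials of `L + c` tend to `-∞` for `c < α`
and to `+∞` for `c > α`, that is, `α` is the critical value, and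
`T_+^{t,s} u(x) = sup_y (u(y) - h_0^{s,t}(x, y)) - α (t - s)` is within `sup |u| + C` of `0`.

The analytic input is the connection of points in unit time with bounded action. In a chart one uses
segments, along which the Lagrangian is bounded since `H` is superlinear uniformly over compact sets
of base points (`exists_uniform_superlinear`): fibrewise convexity reduces this to strict
inequalities on spheres, which persist under small changes of the base point. Along a segment the
Lagrangian is a supremum of continuous functions of time, hence measurable. Connectedness and
compactness of `M` then give uniform bounds for all pairs of points.
-/

/-! ### Linear growth of periodic transition costs -/

/-- A sequence that is additive up to a bounded error stays at bounded distance from a linear one: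
Fekete's lemma applies to `f + C` and to `C - f`. -/
theorem exists_abs_sub_mul_le_of_quasiadditive {f : ℕ → ℝ} {C : ℝ}
    (hf : ∀ m n, |f (m + n) - f m - f n| ≤ C) : ∃ α : ℝ, ∀ n : ℕ, |f n - α * n| ≤ C := by
  have hC : 0 ≤ C := (abs_nonneg _).trans (hf 0 0)
  have hlin : ∀ n : ℕ, |f n| ≤ (|f 1| + C) * n + C := by
    intro n
    induction n with
    | zero =>
      have h := abs_le.1 (hf 0 0)
      simp only [add_zero, sub_self, zero_sub] at h
      simp only [Nat.cast_zero, mul_zero, zero_add]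
      exact abs_le.2 ⟨by linarith, by linarith⟩
    | succ n ih =>
      have h := abs_le.1 (hf n 1)
      have h1 := abs_le.1 ih
      have h2 := abs_le.1 (le_refl |f 1|)
      push_cast
      exact abs_le.2 ⟨by linarith, by linarith⟩
  have hdiv : ∀ n : ℕ, |f n| / n ≤ |f 1| + C + C := by
    intro n
    rcases Nat.eq_zero_or_pos n with rfl | hn
    · simp only [Nat.cast_zero, div_zero]; positivity
    · have hn' : (1 : ℝ) ≤ n := by exact_mod_cast hn
      rw [div_le_iff₀ (by linarith)]
      nlinarith [hlin n, abs_nonneg (f 1)]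
  have hsub : Subadditive fun n => f n + C := fun m n => by
    have := abs_le.1 (hf m n); dsimp only; linarith
  have hsup : Subadditive fun n => C - f n := fun m n => by
    have := abs_le.1 (hf m n); dsimp only; linarith
  have hbdd : ∀ g : ℕ → ℝ, (∀ n, -|f n| ≤ g n) → BddBelow (Set.range fun n : ℕ => g n / n) := by
    rintro g hg
    refine ⟨-(|f 1| + C + C), ?_⟩
    rintro _ ⟨n, rfl⟩
    have h1 : -|f n| / (n : ℝ) ≤ g n / n := by gcongr; exact hg n
    have h2 := hdiv n
    rw [neg_div] at h1
    dsimp only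
    linarith
  have hb1 := hbdd (fun n => f n + C) fun n => by have := neg_abs_le (f n); linarith
  have hb2 := hbdd (fun n => C - f n) fun n => by have := le_abs_self (f n); linarith
  have hlim : hsup.lim = -hsub.lim := by
    refine tendsto_nhds_unique (hsup.tendsto_lim hb2) ?_
    have h1 := (hsub.tendsto_lim hb1).neg
    have h2 : Filter.Tendsto (fun n : ℕ => (C + C) / (n : ℝ)) Filter.atTop (𝓝 0) :=
      tendsto_const_div_atTop_nhds_zero_nat _
    have h3 := h1.add h2
    rw [add_zero] at h3
    refine h3.congr fun n => ?_
    rw [← neg_div, ← add_div]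
    congr 1
    ring
  refine ⟨hsub.lim, fun n => ?_⟩
  rcases Nat.eq_zero_or_pos n with rfl | hn
  · have := hlin 0
    simpa using this
  · have hn' : (0 : ℝ) < n := by exact_mod_cast hn
    have h1 := hsub.lim_le_div hb1 hn.ne'
    have h2 := hsup.lim_le_div hb2 hn.ne'
    rw [hlim] at h2
    rw [le_div_iff₀ hn'] at h1 h2
    exact abs_le.2 ⟨by linarith, by linarith⟩

/-- The properties of the relation "`x` at time `s` can be joined to `y` at time `t` with action
`a`" that govern the long-time behaviour of the minimal action, for a `1`-periodic problem on a
compact connected space. -/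
structure IsTransitionCost {M : Type*} (R : ℝ → ℝ → M → M → ℝ → Prop) (K : ℝ) : Prop where
  concat : ∀ {s r t : ℝ} {x y z : M} {a b : ℝ}, s ≤ r → r ≤ t → R s r x y a → R r t y z b →
    R s t x z (a + b)
  split : ∀ {s r t : ℝ} {x z : M} {c : ℝ}, s ≤ r → r ≤ t → R s t x z c →
    ∃ (y : M) (a b : ℝ), R s r x y a ∧ R r t y z b ∧ a + b = c
  shift : ∀ {s t : ℝ} {x y : M} {a : ℝ} (k : ℤ), R s t x y a → R (s + k) (t + k) x y a
  lower : ∀ {s t : ℝ} {x y : M} {a : ℝ}, s ≤ t → R s t x y a → -(K * (t - s)) ≤ a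
  connect : ∀ (s : ℝ) (x y : M), ∃ a ≤ K, R s (s + 1) x y a

namespace IsTransitionCost

variable {M : Type*} {R : ℝ → ℝ → M → M → ℝ → Prop} {K : ℝ}

/-- The minimal cost of a transition from time `s` to time `t`, whatever its endpoints. -/
noncomputable def minCost (R : ℝ → ℝ → M → M → ℝ → Prop) (s t : ℝ) : ℝ :=
  sInf {a : ℝ | ∃ x y, R s t x y a}

theorem bddBelow (hR : IsTransitionCost R K) {s t : ℝ} (hst : s ≤ t) :
    BddBelow {a : ℝ | ∃ x y, R s t x y a} :=
  ⟨-(K * (t - s)), fun _ ⟨_, _, h⟩ => hR.lower hst h⟩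

theorem minCost_le (hR : IsTransitionCost R K) {s t : ℝ} (hst : s ≤ t) {x y : M} {a : ℝ}
    (h : R s t x y a) : minCost R s t ≤ a :=
  csInf_le (hR.bddBelow hst) ⟨x, y, h⟩

theorem exists_of_nat [Nonempty M] (hR : IsTransitionCost R K) (s : ℝ) (n : ℕ) :
    ∃ x y a, R s (s + (n + 1 : ℕ)) x y a := by
  obtain ⟨x⟩ := ‹Nonempty M›
  refine ⟨x, x, ?_⟩
  induction n with
  | zero =>
    obtain ⟨a, -, h⟩ := hR.connect s x x
    exact ⟨a, by simpa using h⟩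
  | succ n ih =>
    obtain ⟨a, ha⟩ := ih
    obtain ⟨b, -, hb⟩ := hR.connect (s + (n + 1 : ℕ)) x x
    have h := hR.concat (le_add_of_nonneg_right (Nat.cast_nonneg _)) (by linarith) ha hb
    refine ⟨a + b, ?_⟩
    rwa [add_assoc, show ((n + 1 : ℕ) : ℝ) + 1 = ((n + 1 + 1 : ℕ) : ℝ) by push_cast; ring] at h

theorem nonempty [Nonempty M] (hR : IsTransitionCost R K) {s t : ℝ} (hst : s ≤ t) :
    {a : ℝ | ∃ x y, R s t x y a}.Nonempty := by
  obtain ⟨n, hn⟩ := exists_nat_ge (t - s)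
  obtain ⟨x, y, a, h⟩ := hR.exists_of_nat s n
  obtain ⟨z, b, -, hb, -⟩ := hR.split hst (by push_cast; linarith) h
  exact ⟨b, x, z, hb⟩

theorem exists_lt [Nonempty M] (hR : IsTransitionCost R K) {s t ε : ℝ} (hst : s ≤ t) (hε : 0 < ε) :
    ∃ x y a, R s t x y a ∧ a < minCost R s t + ε := by
  obtain ⟨a, ⟨x, y, h⟩, ha⟩ :=
    exists_lt_of_csInf_lt (hR.nonempty hst) (lt_add_of_pos_right (minCost R s t) hε)
  exact ⟨x, y, a, h, ha⟩

theorem lower_minCost [Nonempty M] (hR : IsTransitionCost R K) {s t : ℝ} (hst : s ≤ t) :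
    -(K * (t - s)) ≤ minCost R s t :=
  le_csInf (hR.nonempty hst) fun _ ⟨_, _, h⟩ => hR.lower hst h

theorem minCost_add_le [Nonempty M] (hR : IsTransitionCost R K) {s r t : ℝ} (hsr : s ≤ r)
    (hrt : r ≤ t) : minCost R s r + minCost R r t ≤ minCost R s t := by
  refine le_csInf (hR.nonempty (hsr.trans hrt)) ?_
  rintro c ⟨x, z, h⟩
  obtain ⟨y, a, b, ha, hb, rfl⟩ := hR.split hsr hrt h
  exact add_le_add (hR.minCost_le hsr ha) (hR.minCost_le hrt hb)

theorem minCost_shift (hR : IsTransitionCost R K) (s t : ℝ) (k : ℤ) :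
    minCost R (s + k) (t + k) = minCost R s t := by
  unfold minCost
  congr 1
  ext a
  constructor
  · rintro ⟨x, y, h⟩
    have := hR.shift (-k) h
    push_cast at this
    exact ⟨x, y, by simpa using this⟩
  · rintro ⟨x, y, h⟩
    exact ⟨x, y, hR.shift k h⟩

/-- Every point is the start of an almost minimal transition: first move, in unit time, to the
starting point of an almost minimal transition shifted by one period, and then discard the last unit
of time. -/
theorem exists_from [Nonempty M] (hR : IsTransitionCost R K) {s t : ℝ} (hst : s ≤ t) (x : M) :
    ∃ y a, R s t x y a ∧ a ≤ minCost R s t + (2 * K + 1) := by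
  obtain ⟨z, w, b, hb, hlt⟩ := hR.exists_lt hst one_pos
  obtain ⟨a, ha, hxa⟩ := hR.connect s x z
  have hb' := hR.shift 1 hb
  rw [Int.cast_one] at hb'
  have h := hR.concat (by linarith) (by linarith) hxa hb'
  obtain ⟨y, c, e, hc, he, hce⟩ := hR.split hst (by linarith) h
  have := hR.lower (by linarith) he
  exact ⟨y, c, hc, by linarith⟩

/-- The defect of additivity is bounded: an almost minimal transition on `[r, t]` may be started
where one on `[s, r]` ends. -/
theorem minCost_le_add [Nonempty M] (hR : IsTransitionCost R K) {s r t : ℝ} (hsr : s ≤ r)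
    (hrt : r ≤ t) : minCost R s t ≤ minCost R s r + minCost R r t + (2 * K + 2) := by
  obtain ⟨x, y, a, ha, hlt⟩ := hR.exists_lt hsr one_pos
  obtain ⟨z, b, hb, hle⟩ := hR.exists_from hrt y
  have := hR.minCost_le (hsr.trans hrt) (hR.concat hsr hrt ha hb)
  linarith

/-- The minimal cost grows linearly in time, up to a bounded error. -/
theorem exists_abs_minCost_le [Nonempty M] (hR : IsTransitionCost R K) (hK : 0 ≤ K) :
    ∃ α C : ℝ, ∀ s t : ℝ, s ≤ t → |minCost R s t + α * (t - s)| ≤ C := by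
  have hnat : ∀ n : ℕ, (0 : ℝ) ≤ n := fun n => Nat.cast_nonneg n
  obtain ⟨β, hβ⟩ := exists_abs_sub_mul_le_of_quasiadditive (f := fun n : ℕ => minCost R 0 n)
    (C := 2 * K + 2) (fun m n => by
      have h1 := hR.minCost_add_le (hnat m) (by linarith [hnat n] : (m : ℝ) ≤ n + m)
      have h2 := hR.minCost_le_add (hnat m) (by linarith [hnat n] : (m : ℝ) ≤ n + m)
      have h3 := hR.minCost_shift 0 n m
      rw [zero_add, Int.cast_natCast] at h3
      rw [Nat.cast_add, add_comm (m : ℝ) n]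
      exact abs_le.2 ⟨by linarith, by linarith⟩)
  -- an upper bound for the cost of transitions of duration at most one
  have hshort : ∀ s t : ℝ, s ≤ t → t ≤ s + 1 → |minCost R s t| ≤ 2 * K := by
    intro s t hst hts
    obtain ⟨x⟩ := ‹Nonempty M›
    obtain ⟨a, ha, hx⟩ := hR.connect s x x
    obtain ⟨y, b, c, hb, hc, hbc⟩ := hR.split hst hts hx
    have h1 := hR.lower hts hc
    have h2 := hR.minCost_le hst hb
    have h3 := hR.lower_minCost hst
    have h4 : K * (t - s) ≤ K := by nlinarith
    have h5 : K * (s + 1 - t) ≤ K := by nlinarith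
    exact abs_le.2 ⟨by linarith, by linarith⟩
  refine ⟨-β, (2 * K + 2) + 2 * (2 * K) + 2 * (2 * K + 2) + 2 * |β|, fun s t hst => ?_⟩
  -- compare `[s, t]` with the interval `[⌊s⌋, ⌈t⌉]`, an integer translate of `[0, n]`
  have hs1 := Int.floor_le s
  have hs2 := (Int.lt_floor_add_one s).le
  have ht1 := Int.le_ceil t
  have ht2 := (Int.ceil_lt_add_one t).le
  obtain ⟨n, hn⟩ : ∃ n : ℕ, (⌈t⌉ : ℤ) = ⌊s⌋ + n := by
    have : ⌊s⌋ ≤ ⌈t⌉ := by exact_mod_cast hs1.trans (hst.trans ht1)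
    obtain ⟨n, hn⟩ := Int.le.dest this
    exact ⟨n, hn.symm⟩
  have hn' : (⌈t⌉ : ℝ) = n + ⌊s⌋ := by rw [hn]; push_cast; ring
  have e1 := abs_le.1 (hβ n)
  have e2 := hR.minCost_shift 0 n ⌊s⌋
  rw [zero_add, ← hn'] at e2
  have e3 := abs_le.1 (hshort _ _ hs1 hs2)
  have e4 := abs_le.1 (hshort _ _ ht1 ht2)
  have f1 := hR.minCost_add_le hs1 (hst.trans ht1)
  have f2 := hR.minCost_add_le hst ht1
  have f3 := hR.minCost_le_add hs1 (hst.trans ht1)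
  have f4 := hR.minCost_le_add hst ht1
  have g1 : |β * (t - s) - β * n| ≤ 2 * |β| := by
    rw [← mul_sub, abs_mul, mul_comm]
    gcongr
    exact abs_le.2 ⟨by linarith, by linarith⟩
  have g2 := abs_le.1 g1
  exact abs_le.2 ⟨by linarith, by linarith⟩

/-- The action needed to go from time `s` to time `t` is `-α (t - s)` up to a bounded error: this is
a lower bound for all transitions, it is attained from every starting point, and between any two
points as soon as `t - s ≥ 1`. -/
theorem exists_linear_growth [Nonempty M] (hR : IsTransitionCost R K) (hK : 0 ≤ K) :
    ∃ α C : ℝ, ∀ s t : ℝ, s ≤ t →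
      (∀ x y a, R s t x y a → -α * (t - s) - C ≤ a) ∧
      (∀ x, ∃ y a, R s t x y a ∧ a ≤ -α * (t - s) + C) ∧
      (s + 1 ≤ t → ∀ x y, ∃ a, R s t x y a ∧ a ≤ -α * (t - s) + C) := by
  obtain ⟨α, C, h⟩ := hR.exists_abs_minCost_le hK
  refine ⟨α, C + |α| + 3 * K + 1, fun s t hst => ?_⟩
  have h1 := abs_le.1 (h s t hst)
  have h2 := abs_nonneg α
  refine ⟨fun x y a ha => ?_, fun x => ?_, fun hst' x y => ?_⟩
  · have := hR.minCost_le hst ha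
    linarith
  · obtain ⟨y, a, ha, hle⟩ := hR.exists_from hst x
    exact ⟨y, a, ha, by linarith⟩
  · have hst1 : s ≤ t - 1 := by linarith
    obtain ⟨z, a, ha, hle⟩ := hR.exists_from hst1 x
    obtain ⟨b, hb, hzy⟩ := hR.connect (t - 1) z y
    rw [sub_add_cancel] at hzy
    have h3 := abs_le.1 (h s (t - 1) hst1)
    have h4 := le_abs_self α
    exact ⟨a + b, hR.concat hst1 (by linarith) ha hzy, by linarith⟩

end IsTransitionCost

noncomputable section

/-! ### Absolutely continuous functions on intervals -/

namespace AbsolutelyContinuousOnInterval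

variable {X : Type*} [PseudoMetricSpace X] {f g : ℝ → X} {a b r : ℝ}

theorem congr_of_eqOn (hf : AbsolutelyContinuousOnInterval f a b)
    (h : Set.EqOn f g (Set.uIcc a b)) :
    AbsolutelyContinuousOnInterval g a b := by
  rw [absolutelyContinuousOnInterval_iff] at hf ⊢
  intro ε hε
  obtain ⟨δ, hδ, H⟩ := hf ε hε
  refine ⟨δ, hδ, fun E hE hlt => ?_⟩
  refine lt_of_eq_of_lt (Finset.sum_congr rfl fun i hi => ?_) (H E hE hlt)
  rw [h (hE.1 i hi).1, h (hE.1 i hi).2]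

theorem comp_add_const (c : ℝ) (hf : AbsolutelyContinuousOnInterval f (a + c) (b + c)) :
    AbsolutelyContinuousOnInterval (fun τ => f (τ + c)) a b := by
  rw [absolutelyContinuousOnInterval_iff] at hf ⊢
  intro ε hε
  obtain ⟨δ, hδ, H⟩ := hf ε hε
  refine ⟨δ, hδ, fun E hE hlt => ?_⟩
  have hmem : ∀ x, x ∈ Set.uIcc a b → x + c ∈ Set.uIcc (a + c) (b + c) := fun x hx => by
    simp only [Set.mem_uIcc] at hx ⊢
    rcases hx with h | h
    · exact Or.inl ⟨by linarith, by linarith⟩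
    · exact Or.inr ⟨by linarith, by linarith⟩
  refine H (E.1, fun i => ((E.2 i).1 + c, (E.2 i).2 + c))
    ⟨fun i hi => ⟨hmem _ (hE.1 i hi).1, hmem _ (hE.1 i hi).2⟩, ?_⟩ (by simpa using hlt)
  intro i hi j hj hij
  have := hE.2 hi hj hij
  simp only [Function.onFun, Set.disjoint_left, Set.mem_uIoc] at this ⊢
  intro x hx hx'
  refine this (a := x - c) ?_ ?_
  · rcases hx with h | h
    · exact Or.inl ⟨by linarith, by linarith⟩
    · exact Or.inr ⟨by linarith, by linarith⟩
  · rcases hx' with h | h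
    · exact Or.inl ⟨by linarith, by linarith⟩
    · exact Or.inr ⟨by linarith, by linarith⟩

/-- Absolute continuity on two adjacent intervals gives absolute continuity on their union: a
family of disjoint intervals is cut at the common endpoint. -/
theorem union (har : a ≤ r) (hrb : r ≤ b) (h₁ : AbsolutelyContinuousOnInterval f a r)
    (h₂ : AbsolutelyContinuousOnInterval f r b) : AbsolutelyContinuousOnInterval f a b := by
  rw [absolutelyContinuousOnInterval_iff] at h₁ h₂ ⊢
  intro ε hε
  obtain ⟨δ₁, hδ₁, H₁⟩ := h₁ (ε / 2) (half_pos hε)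
  obtain ⟨δ₂, hδ₂, H₂⟩ := h₂ (ε / 2) (half_pos hε)
  refine ⟨min δ₁ δ₂, lt_min hδ₁ hδ₂, fun E hE hlt => ?_⟩
  -- the interval between `x` and `y` is cut into its parts below and above `r`
  have hdist : ∀ x y : ℝ, dist x y = dist (min x r) (min y r) + dist (max x r) (max y r) := by
    intro x y
    simp only [Real.dist_eq]
    grind
  have hfdist : ∀ x y : ℝ, dist (f x) (f y) ≤
      dist (f (min x r)) (f (min y r)) + dist (f (max x r)) (f (max y r)) := by
    intro x y
    rcases le_total x r with hx | hx <;> rcases le_total y r with hy | hy <;> simp only [hx, hy,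
      min_eq_left, min_eq_right, max_eq_left, max_eq_right, dist_self, add_zero, zero_add, le_refl]
    · exact dist_triangle _ _ _
    · rw [add_comm]; exact dist_triangle _ _ _
  have hmin : (E.1, fun i => (min (E.2 i).1 r, min (E.2 i).2 r)) ∈ disjWithin a r := by
    refine ⟨fun i hi => ?_, fun i hi j hj hij => ?_⟩
    · have := hE.1 i hi
      rw [Set.uIcc_of_le (har.trans hrb)] at this
      rw [Set.uIcc_of_le har]
      exact ⟨⟨le_min this.1.1 har, min_le_right _ _⟩, ⟨le_min this.2.1 har, min_le_right _ _⟩⟩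
    · refine (hE.2 hi hj hij).mono ?_ ?_ <;>
      · intro x
        simp only [Set.mem_uIoc]
        grind
  have hmax : (E.1, fun i => (max (E.2 i).1 r, max (E.2 i).2 r)) ∈ disjWithin r b := by
    refine ⟨fun i hi => ?_, fun i hi j hj hij => ?_⟩
    · have := hE.1 i hi
      rw [Set.uIcc_of_le (har.trans hrb)] at this
      rw [Set.uIcc_of_le hrb]
      exact ⟨⟨le_max_right _ _, max_le this.1.2 hrb⟩, ⟨le_max_right _ _, max_le this.2.2 hrb⟩⟩
    · refine (hE.2 hi hj hij).mono ?_ ?_ <;>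
      · intro x
        simp only [Set.mem_uIoc]
        grind
  have hsum : ∑ i ∈ Finset.range E.1, dist (E.2 i).1 (E.2 i).2 =
      ∑ i ∈ Finset.range E.1, dist (min (E.2 i).1 r) (min (E.2 i).2 r) +
        ∑ i ∈ Finset.range E.1, dist (max (E.2 i).1 r) (max (E.2 i).2 r) := by
    rw [← Finset.sum_add_distrib]
    exact Finset.sum_congr rfl fun i _ => hdist _ _
  have hn₁ : 0 ≤ ∑ i ∈ Finset.range E.1, dist (min (E.2 i).1 r) (min (E.2 i).2 r) :=
    Finset.sum_nonneg fun _ _ => dist_nonneg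
  have hn₂ : 0 ≤ ∑ i ∈ Finset.range E.1, dist (max (E.2 i).1 r) (max (E.2 i).2 r) :=
    Finset.sum_nonneg fun _ _ => dist_nonneg
  have l₁ := H₁ _ hmin (by have := hlt.trans_le (min_le_left _ _); dsimp only; linarith)
  have l₂ := H₂ _ hmax (by have := hlt.trans_le (min_le_right _ _); dsimp only; linarith)
  refine lt_of_le_of_lt (Finset.sum_le_sum fun i _ => hfdist _ _) ?_
  rw [Finset.sum_add_distrib]
  dsimp only at l₁ l₂
  linarith

end AbsolutelyContinuousOnInterval

namespace WeakKAM

variable {d : ℕ} {M : Type*} [TopologicalSpace M] [ChartedSpace (Model d) M]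

/-! ### Action of concatenated, restricted and shifted curves -/

section Curves

variable {γ γ₁ γ₂ : ℝ → M} {s r t : ℝ}

theorem IsACCurve.restrict (h : IsACCurve d γ s t) {s' t' : ℝ} (hs : s ≤ s') (ht : t' ≤ t) :
    IsACCurve d γ s' t' :=
  ⟨h.1.mono (Set.Icc_subset_Icc hs ht), fun x a b ha hab hb =>
    h.2 x a b (hs.trans ha) hab (hb.trans ht)⟩

theorem IsACCurve.congr (h : IsACCurve d γ₁ s t) (heq : Set.EqOn γ₁ γ₂ (Set.Icc s t)) :
    IsACCurve d γ₂ s t := by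
  refine ⟨h.1.congr heq.symm, fun x a b ha hab hb hmem => ?_⟩
  have hsub : Set.Icc a b ⊆ Set.Icc s t := Set.Icc_subset_Icc ha hb
  refine (h.2 x a b ha hab hb fun τ hτ => ?_).congr_of_eqOn ?_
  · rw [heq (hsub hτ)]; exact hmem τ hτ
  · rw [Set.uIcc_of_le hab]
    intro τ hτ
    simp only [heq (hsub hτ)]

theorem IsACCurve.union (hsr : s ≤ r) (hrt : r ≤ t) (h₁ : IsACCurve d γ s r)
    (h₂ : IsACCurve d γ r t) : IsACCurve d γ s t := by
  refine ⟨?_, fun x a b ha hab hb hmem => ?_⟩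
  · rw [← Set.Icc_union_Icc_eq_Icc hsr hrt]
    exact h₁.1.union_of_isClosed h₂.1 isClosed_Icc isClosed_Icc
  · rcases le_total b r with hbr | hbr
    · exact h₁.2 x a b ha hab hbr hmem
    rcases le_total r a with hra | hra
    · exact h₂.2 x a b hra hab hb hmem
    exact (h₁.2 x a r ha hra le_rfl fun τ hτ => hmem τ ⟨hτ.1, hτ.2.trans hbr⟩).union hra hbr
      (h₂.2 x r b le_rfl hbr hb fun τ hτ => hmem τ ⟨hra.trans hτ.1, hτ.2⟩)

theorem IsACCurve.shift (h : IsACCurve d γ s t) (c : ℝ) :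
    IsACCurve d (fun τ => γ (τ - c)) (s + c) (t + c) := by
  refine ⟨?_, fun x a b ha hab hb hmem => ?_⟩
  · refine h.1.comp (by fun_prop) fun τ hτ => ⟨?_, ?_⟩
    · linarith [hτ.1]
    · linarith [hτ.2]
  · simp only [sub_eq_add_neg]
    refine AbsolutelyContinuousOnInterval.comp_add_const
      (f := fun τ => extChartAt (𝓡 d) x (γ τ)) (-c) ?_
    refine h.2 x _ _ (by linarith) (by linarith) (by linarith) fun τ hτ => ?_
    have := hmem (τ + c) ⟨by linarith [hτ.1], by linarith [hτ.2]⟩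
    simpa only [add_sub_cancel_right] using this

/-- The Lagrangian along a curve. -/
def lagrangianAlong (H : ℝ → CotangentBundle d M → ℝ) (γ : ℝ → M) (τ : ℝ) : ℝ :=
  lagrangian H τ (γ τ) (velocity d γ τ)

variable {H : ℝ → CotangentBundle d M → ℝ}

/-- Congruence for the Lagrangian when the base points agree only propositionally; the vectors are
then compared in the model space, with which every tangent space is identified. -/
theorem lagrangian_velocity_congr {τ₁ τ₂ : ℝ} {x y : M} {v : TangentSpace (𝓡 d) x}
    {w : TangentSpace (𝓡 d) y} (hH : ∀ z, H τ₁ z = H τ₂ z) (hxy : x = y)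
    (hvw : (v : Model d) = (w : Model d)) : lagrangian H τ₁ x v = lagrangian H τ₂ y w := by
  subst hxy
  have hvw' : v = w := hvw
  subst hvw'
  simp only [lagrangian, hH]

theorem lagrangianAlong_congr {τ : ℝ} (h : γ₁ =ᶠ[𝓝 τ] γ₂) :
    lagrangianAlong H γ₁ τ = lagrangianAlong H γ₂ τ := by
  refine lagrangian_velocity_congr (fun _ => rfl) h.self_of_nhds ?_
  have : (mfderiv 𝓘(ℝ, ℝ) (𝓡 d) γ₁ τ : ℝ →L[ℝ] Model d) = mfderiv 𝓘(ℝ, ℝ) (𝓡 d) γ₂ τ :=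
    h.mfderiv_eq
  exact congrArg (fun A : ℝ →L[ℝ] Model d => A 1) this

theorem velocity_sub_const (γ : ℝ → M) (c τ : ℝ) :
    (velocity d (fun σ => γ (σ - c)) τ : Model d) = (velocity d γ (τ - c) : Model d) := by
  have key : ∀ (γ : ℝ → M) (c τ : ℝ), MDifferentiableAt 𝓘(ℝ, ℝ) (𝓡 d) γ (τ - c) →
      HasMFDerivAt 𝓘(ℝ, ℝ) (𝓡 d) (fun σ => γ (σ - c)) τ
        (mfderiv 𝓘(ℝ, ℝ) (𝓡 d) γ (τ - c) : ℝ →L[ℝ] Model d) := by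
    intro γ c τ h
    have h1 : HasFDerivAt (fun σ : ℝ => σ - c) (ContinuousLinearMap.id ℝ ℝ) τ :=
      (hasFDerivAt_id τ).sub_const c
    exact HasMFDerivAt.comp τ h.hasMFDerivAt h1.hasMFDerivAt
  by_cases h : MDifferentiableAt 𝓘(ℝ, ℝ) (𝓡 d) γ (τ - c)
  · have := (key γ c τ h).mfderiv
    exact congrArg (fun A : ℝ →L[ℝ] Model d => A 1) this
  -- otherwise both velocities have the junk value `0`
  · have h' : ¬ MDifferentiableAt 𝓘(ℝ, ℝ) (𝓡 d) (fun σ => γ (σ - c)) τ := by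
      intro h2
      have h3 := key (fun σ => γ (σ - c)) (-c) (τ - c) (by simpa using h2)
      have e : (fun σ => γ (σ - -c - c)) = γ := funext fun σ => by simp
      exact h (e ▸ h3.mdifferentiableAt)
    have e1 : (mfderiv 𝓘(ℝ, ℝ) (𝓡 d) γ (τ - c) : ℝ →L[ℝ] Model d) = 0 :=
      mfderiv_zero_of_not_mdifferentiableAt h
    have e2 : (mfderiv 𝓘(ℝ, ℝ) (𝓡 d) (fun σ => γ (σ - c)) τ : ℝ →L[ℝ] Model d) = 0 :=
      mfderiv_zero_of_not_mdifferentiableAt h'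
    exact congrArg (fun A : ℝ →L[ℝ] Model d => A 1) (e2.trans e1.symm)

theorem lagrangianAlong_shift {c : ℝ} (hH : ∀ τ z, H (τ + c) z = H τ z) (γ : ℝ → M) (τ : ℝ) :
    lagrangianAlong H (fun σ => γ (σ - c)) τ = lagrangianAlong H γ (τ - c) := by
  refine lagrangian_velocity_congr (fun z => ?_) rfl (velocity_sub_const γ c τ)
  rw [← hH (τ - c), sub_add_cancel]

/-- `x` at time `s` is joined to `y` at time `t` by an absolutely continuous curve along which the
Lagrangian is integrable, with integral `a`. -/
def Reach (H : ℝ → CotangentBundle d M → ℝ) (s t : ℝ) (x y : M) (a : ℝ) : Prop :=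
  ∃ γ : ℝ → M, IsACCurve d γ s t ∧ γ s = x ∧ γ t = y ∧
    IntervalIntegrable (lagrangianAlong H γ) MeasureTheory.volume s t ∧
    ∫ τ in s..t, lagrangianAlong H γ τ = a

/-- The velocity at an endpoint depends on values of the curve outside `[s, t]`, so that curves
which agree on `(s, t)` have the same Lagrangian only almost everywhere on `[s, t]`. -/
theorem lagrangianAlong_ae_eq (hst : s ≤ t) (h : Set.EqOn γ₁ γ₂ (Set.Ioo s t)) :
    ∀ᵐ τ ∂MeasureTheory.volume, τ ∈ Set.uIoc s t →
      lagrangianAlong H γ₁ τ = lagrangianAlong H γ₂ τ := by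
  have h1 : ∀ᵐ τ ∂(MeasureTheory.volume : MeasureTheory.Measure ℝ), τ ≠ t := by
    simp [MeasureTheory.ae_iff]
  filter_upwards [h1] with τ hτ hmem
  rw [Set.uIoc_of_le hst] at hmem
  exact lagrangianAlong_congr
    (h.eventuallyEq_of_mem (isOpen_Ioo.mem_nhds ⟨hmem.1, lt_of_le_of_ne hmem.2 hτ⟩))

theorem intervalIntegrable_lagrangianAlong_congr (hst : s ≤ t) (h : Set.EqOn γ₁ γ₂ (Set.Ioo s t))
    (h₁ : IntervalIntegrable (lagrangianAlong H γ₁) MeasureTheory.volume s t) :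
    IntervalIntegrable (lagrangianAlong H γ₂) MeasureTheory.volume s t :=
  h₁.congr_ae ((MeasureTheory.ae_restrict_iff' measurableSet_uIoc).2 (lagrangianAlong_ae_eq hst h))

theorem Reach.concat {x y z : M} {a b : ℝ} (hsr : s ≤ r) (hrt : r ≤ t)
    (h₁ : Reach H s r x y a) (h₂ : Reach H r t y z b) : Reach H s t x z (a + b) := by
  obtain ⟨γ₁, ac₁, i₁, e₁, int₁, rfl⟩ := h₁
  obtain ⟨γ₂, ac₂, i₂, e₂, int₂, rfl⟩ := h₂
  let γ : ℝ → M := fun τ => if τ ≤ r then γ₁ τ else γ₂ τ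
  have q₁ : Set.EqOn γ₁ γ (Set.Icc s r) := fun τ hτ => by simp [γ, hτ.2]
  have q₂ : Set.EqOn γ₂ γ (Set.Icc r t) := fun τ hτ => by
    rcases hτ.1.eq_or_lt with rfl | h
    · simp [γ, e₁, i₂]
    · simp [γ, not_le.2 h]
  have q₁' := q₁.mono Set.Ioo_subset_Icc_self
  have q₂' := q₂.mono Set.Ioo_subset_Icc_self
  have int₁' := intervalIntegrable_lagrangianAlong_congr hsr q₁' int₁
  have int₂' := intervalIntegrable_lagrangianAlong_congr hrt q₂' int₂
  refine ⟨γ, (ac₁.congr q₁).union hsr hrt (ac₂.congr q₂), ?_, ?_, int₁'.trans int₂', ?_⟩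
  · rw [← q₁ ⟨le_rfl, hsr⟩, i₁]
  · rw [← q₂ ⟨hrt, le_rfl⟩, e₂]
  · rw [← intervalIntegral.integral_add_adjacent_intervals int₁' int₂',
      intervalIntegral.integral_congr_ae (lagrangianAlong_ae_eq hsr q₁'),
      intervalIntegral.integral_congr_ae (lagrangianAlong_ae_eq hrt q₂')]

theorem Reach.split {x z : M} {c : ℝ} (hsr : s ≤ r) (hrt : r ≤ t) (h : Reach H s t x z c) :
    ∃ y a b, Reach H s r x y a ∧ Reach H r t y z b ∧ a + b = c := by
  obtain ⟨γ, ac, i, e, int, rfl⟩ := h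
  have int₁ := int.mono_set (c := s) (d := r) (by
    rw [Set.uIcc_of_le hsr, Set.uIcc_of_le (hsr.trans hrt)]; exact Set.Icc_subset_Icc_right hrt)
  have int₂ := int.mono_set (c := r) (d := t) (by
    rw [Set.uIcc_of_le hrt, Set.uIcc_of_le (hsr.trans hrt)]; exact Set.Icc_subset_Icc_left hsr)
  exact ⟨γ r, _, _, ⟨γ, ac.restrict le_rfl hrt, i, rfl, int₁, rfl⟩,
    ⟨γ, ac.restrict hsr le_rfl, rfl, e, int₂, rfl⟩,
    intervalIntegral.integral_add_adjacent_intervals int₁ int₂⟩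

theorem Reach.shift {x y : M} {a c : ℝ} (hH : ∀ τ z, H (τ + c) z = H τ z)
    (h : Reach H s t x y a) : Reach H (s + c) (t + c) x y a := by
  obtain ⟨γ, ac, i, e, int, rfl⟩ := h
  have heq : lagrangianAlong H (fun τ => γ (τ - c)) = fun τ => lagrangianAlong H γ (τ - c) :=
    funext fun τ => lagrangianAlong_shift hH γ τ
  refine ⟨fun τ => γ (τ - c), ac.shift c, by simpa using i, by simpa using e, ?_, ?_⟩
  · rw [heq]; exact int.comp_sub_right c
  · rw [heq, intervalIntegral.integral_comp_sub_right (fun τ => lagrangianAlong H γ τ)]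
    simp

theorem Reach.lower {x y : M} {a K : ℝ} (hK : ∀ τ x v, -K ≤ lagrangian H τ x v) (hst : s ≤ t)
    (h : Reach H s t x y a) : -(K * (t - s)) ≤ a := by
  obtain ⟨γ, -, -, -, int, rfl⟩ := h
  have := intervalIntegral.integral_mono_on hst (intervalIntegrable_const (c := -K)) int
    fun τ _ => hK τ _ _
  rw [intervalIntegral.integral_const, smul_eq_mul] at this
  linarith

theorem potential_le_of_reach {x y : M} {a : ℝ} (h : Reach H s t x y a) :
    potential H s t x y ≤ (a : EReal) := by
  obtain ⟨γ, ac, i, e, int, rfl⟩ := h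
  refine (iInf₂_le γ ⟨ac, i, e⟩).trans_eq ?_
  exact if_pos int

/-- Curves along which the Lagrangian is not integrable have action `+∞` and do not matter. -/
theorem le_potential {x y : M} {c : ℝ} (h : ∀ a, Reach H s t x y a → c ≤ a) :
    (c : EReal) ≤ potential H s t x y := by
  refine le_iInf₂ fun γ ⟨ac, i, e⟩ => ?_
  by_cases int : IntervalIntegrable (lagrangianAlong H γ) MeasureTheory.volume s t
  · refine le_of_le_of_eq ?_ (if_pos int).symm
    exact EReal.coe_le_coe_iff.2 (h _ ⟨γ, ac, i, e, int, rfl⟩)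
  · exact le_of_le_of_eq le_top (if_neg int).symm

end Curves

end WeakKAM

/-! ### Uniform superlinearity of families of convex functions -/

section Superlinear

variable {F : Type*} [NormedAddCommGroup F] [NormedSpace ℝ F]

/-- A convex function grows at least linearly outside a sphere on which it exceeds its value at the
origin. -/
theorem ConvexOn.le_of_forall_sphere {f : F → ℝ} (hf : ConvexOn ℝ Set.univ f) {r c : ℝ} (hr : 0 < r)
    (h : ∀ q, ‖q‖ = r → c * r ≤ f q - f 0) (q : F) (hq : r ≤ ‖q‖) : c * ‖q‖ ≤ f q - f 0 := by
  have hq0 : 0 < ‖q‖ := hr.trans_le hq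
  have hl0 : 0 ≤ r / ‖q‖ := by positivity
  have hl1 : r / ‖q‖ ≤ 1 := (div_le_one hq0).2 hq
  have h1 := hf.2 (Set.mem_univ (0 : F)) (Set.mem_univ q) (sub_nonneg.2 hl1) hl0 (by ring)
  rw [smul_zero, zero_add, smul_eq_mul, smul_eq_mul] at h1
  have h2 := h ((r / ‖q‖) • q) (by
    rw [norm_smul, Real.norm_of_nonneg hl0, div_mul_cancel₀ _ hq0.ne'])
  have h3 : c * r ≤ (r / ‖q‖) * (f q - f 0) := by linarith
  have h4 : (r / ‖q‖) * (c * ‖q‖) = c * r := by field_simp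
  rw [← h4] at h3
  exact le_of_mul_le_mul_left h3 (by positivity)

variable [FiniteDimensional ℝ F]

/-- A convex function of superlinear absolute value is itself superlinear: it is bounded below by a
linear function of the norm, and hence positive far away. -/
theorem ConvexOn.exists_sphere {f : F → ℝ} (hf : ConvexOn ℝ Set.univ f) (hc : Continuous f)
    (hs : ∀ c : ℝ, ∃ r : ℝ, ∀ q, r ≤ ‖q‖ → c * ‖q‖ ≤ |f q|) (c : ℝ) :
    ∃ r > 0, ∀ q, ‖q‖ = r → c * r < f q - f 0 := by
  obtain ⟨D, hD⟩ := (isCompact_sphere (0 : F) 1).exists_bound_of_continuousOn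
    (f := fun q => f q - f 0) (by fun_prop)
  have hlow : ∀ q, 1 ≤ ‖q‖ → -|D| * ‖q‖ ≤ f q - f 0 := hf.le_of_forall_sphere one_pos fun q hq => by
    have := (hD q (by simpa using hq)).trans (le_abs_self D)
    rw [Real.norm_eq_abs] at this
    linarith [neg_abs_le (f q - f 0)]
  obtain ⟨r, hr⟩ := hs (|c| + |D| + 2 * |f 0| + 1)
  refine ⟨max r 1, by positivity, fun q hq => ?_⟩
  have hq1 : 1 ≤ ‖q‖ := hq ▸ le_max_right _ _
  have h1 := hr q (hq ▸ le_max_left _ _)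
  have h2 := hlow q hq1
  rw [← hq]
  have h3 : |f 0| ≤ |f 0| * ‖q‖ := le_mul_of_one_le_right (abs_nonneg _) hq1
  have h4 : c * ‖q‖ ≤ |c| * ‖q‖ := by gcongr; exact le_abs_self c
  have h5 : 0 ≤ |c| * ‖q‖ := by positivity
  have h6 : 0 ≤ |D| * ‖q‖ := by positivity
  have h7 := abs_le.1 (le_refl |f 0|)
  rcases abs_cases (f q) with ⟨h8, -⟩ | ⟨h8, -⟩ <;> rw [h8] at h1 <;> linarith

/-- Fibrewise superlinearity of a continuous, fibrewise convex family over a compact space is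
uniform: by convexity it is detected on spheres, which are compact. -/
theorem exists_uniform_superlinear {X : Type*} [TopologicalSpace X] [CompactSpace X]
    {h : X → F → ℝ} (hcont : Continuous (Function.uncurry h))
    (hconv : ∀ ξ, ConvexOn ℝ Set.univ (h ξ))
    (hs : ∀ ξ, ∀ c : ℝ, ∃ r : ℝ, ∀ q, r ≤ ‖q‖ → c * ‖q‖ ≤ |h ξ q|) {c : ℝ} (hc : 0 ≤ c) :
    ∃ C : ℝ, ∀ ξ q, c * ‖q‖ - C ≤ h ξ q := by
  suffices H : ∃ C : ℝ, ∀ ξ ∈ (Set.univ : Set X), ∀ q, c * ‖q‖ - C ≤ h ξ q by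
    obtain ⟨C, hC⟩ := H
    exact ⟨C, fun ξ => hC ξ trivial⟩
  refine isCompact_univ.induction_on (p := fun S => ∃ C : ℝ, ∀ ξ ∈ S, ∀ q, c * ‖q‖ - C ≤ h ξ q)
    ⟨0, by simp⟩ (fun S T hST ⟨C, hC⟩ => ⟨C, fun ξ hξ => hC ξ (hST hξ)⟩) ?_ ?_
  · rintro S T ⟨C, hC⟩ ⟨D, hD⟩
    refine ⟨max C D, ?_⟩
    rintro ξ (hξ | hξ) q
    · linarith [hC ξ hξ q, le_max_left C D]
    · linarith [hD ξ hξ q, le_max_right C D]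
  · intro ξ₀ _
    obtain ⟨r, hr, hsph⟩ := (hconv ξ₀).exists_sphere
      (hcont.comp (Continuous.prodMk_right ξ₀)) (hs ξ₀) c
    have hev : ∀ᶠ ξ in 𝓝 ξ₀, ∀ q ∈ Metric.sphere (0 : F) r, c * r < h ξ q - h ξ 0 := by
      refine (isCompact_sphere (0 : F) r).eventually_forall_of_forall_eventually fun q hq => ?_
      have hco : Continuous fun w : X × F => h w.1 w.2 - h w.1 0 :=
        hcont.sub (hcont.comp (continuous_fst.prodMk continuous_const))
      exact hco.continuousAt.eventually (lt_mem_nhds (hsph q (by simpa using hq)))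
    obtain ⟨D, hD⟩ := (isCompact_univ.prod
      (isCompact_closedBall (0 : F) r)).exists_bound_of_continuousOn hcont.continuousOn
    have hD' : ∀ ξ q, ‖q‖ ≤ r → -D ≤ h ξ q := fun ξ q hq => by
      have := hD (ξ, q) ⟨trivial, by simpa using hq⟩
      exact (abs_le.1 this).1
    refine ⟨_, mem_nhdsWithin_of_mem_nhds hev, c * r + D, fun ξ hξ q => ?_⟩
    have hcr : 0 ≤ c * r := by positivity
    rcases le_total ‖q‖ r with hq | hq
    · have h1 := hD' ξ q hq
      have h2 : c * ‖q‖ ≤ c * r := by gcongr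
      linarith
    · have h1 := (hconv ξ).le_of_forall_sphere hr
        (fun q hq => (hξ q (by simpa using hq)).le) q hq
      have h2 := hD' ξ 0 (by simpa using hr.le)
      linarith

end Superlinear

namespace WeakKAM

/-! ### Hamiltonian and Lagrangian in charts -/

section Coordinates

variable {d : ℕ} {M : Type*} [TopologicalSpace M] [ChartedSpace (Model d) M]
  [IsManifold (𝓡 d) ∞ M]

/-- Affine lines in the fibres of `T*M` are smooth. -/
theorem contMDiff_fibre_line (x : M) (p η : CotangentSpace d M x) :
    ContMDiff 𝓘(ℝ, ℝ) (cotangentModel d) ∞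
      (fun r : ℝ => (⟨x, p + r • η⟩ : CotangentBundle d M)) := by
  intro r
  rw [Bundle.contMDiffAt_totalSpace]
  refine ⟨contMDiffAt_const, ?_⟩
  let e := trivializationAt (DualModel d) (CotangentSpace d M) x
  have hx : x ∈ e.baseSet := FiberBundle.mem_baseSet_trivializationAt' x
  have : ∀ r : ℝ, (e ⟨x, p + r • η⟩).2 = (e ⟨x, p⟩).2 + r • (e ⟨x, η⟩).2 := by
    intro r
    have h := (e.linear ℝ hx)
    rw [h.map_add, h.map_smul]
  simp only [e] at this
  simp only [this]
  rw [contMDiffAt_iff_contDiffAt]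
  fun_prop

variable {H : ℝ → CotangentBundle d M → ℝ}

theorem IsTonelli.contDiff_fibre_line (hH : IsTonelli H) (t : ℝ) (x : M)
    (p η : CotangentSpace d M x) : ContDiff ℝ 2 (fun r : ℝ => H t ⟨x, p + r • η⟩) := by
  rw [← contMDiff_iff_contDiff]
  exact hH.contMDiff.comp
    (contMDiff_const.prodMk ((contMDiff_fibre_line x p η).of_le (by norm_cast)))

/-- Positivity of the second derivatives at `0` along all lines of the fibre gives it at all points
of a line, by translation of the base covector. -/
theorem IsTonelli.convexOn_fibre (hH : IsTonelli H) (t : ℝ) (x : M) :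
    ConvexOn ℝ Set.univ (fun p : CotangentSpace d M x => H t ⟨x, p⟩) := by
  have hline : ∀ p η : CotangentSpace d M x, η ≠ 0 →
      ConvexOn ℝ Set.univ (fun r : ℝ => H t ⟨x, p + r • η⟩) := by
    intro p η hη
    have hd := hH.contDiff_fibre_line t x p η
    refine convexOn_univ_of_deriv2_nonneg (hd.differentiable (by norm_num))
      ((ContDiff.iterate_deriv' 1 1 hd).differentiable (by norm_num)) fun r => ?_
    have h := hH.strictConvex t x (p + r • η) η hη
    have e : (fun r' : ℝ => H t ⟨x, p + r • η + r' • η⟩) =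
        fun r' : ℝ => (fun σ : ℝ => H t ⟨x, p + σ • η⟩) (r + r') := by
      funext r'
      simp only [add_smul, add_assoc]
    rw [e, congrFun (iteratedDeriv_comp_const_add 2 (fun σ : ℝ => H t ⟨x, p + σ • η⟩) r) 0,
      iteratedDeriv_eq_iterate, add_zero] at h
    exact h.le
  refine ⟨convex_univ, fun p _ p' _ a b ha hb hab => ?_⟩
  obtain rfl : a = 1 - b := by linarith
  by_cases hη : p' - p = 0
  · obtain rfl : p' = p := sub_eq_zero.1 hη
    rw [← add_smul, sub_add_cancel, one_smul, ← add_smul, sub_add_cancel, one_smul]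
  · have h := (hline p (p' - p) hη).2 (Set.mem_univ 0) (Set.mem_univ 1) ha hb hab
    simp only [smul_eq_mul, mul_zero, mul_one, zero_add, zero_smul, add_zero, one_smul,
      add_sub_cancel] at h ⊢
    convert h using 3
    module

/-- The covector at `y` with coordinates `q` in the chart at `z`. -/
def covector (z y : M) (q : DualModel d) : CotangentSpace d M y :=
  (trivializationAt (DualModel d) (CotangentSpace d M) z).symm y q

theorem mem_baseSet_cotangent {z y : M} (hy : y ∈ (chartAt (Model d) z).source) :
    y ∈ (trivializationAt (DualModel d) (CotangentSpace d M) z).baseSet := by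
  rw [hom_trivializationAt_baseSet]
  exact ⟨hy, trivial⟩

theorem continuousOn_covector (z : M) :
    ContinuousOn (fun w : M × DualModel d => (⟨w.1, covector z w.1 w.2⟩ : CotangentBundle d M))
      ((chartAt (Model d) z).source ×ˢ Set.univ) := by
  exact (trivializationAt (DualModel d) (CotangentSpace d M) z).continuousOn_symm.mono
    (Set.prod_mono (fun _ hy => mem_baseSet_cotangent hy) le_rfl)

/-- `covector z y` as a linear isomorphism from the model fibre onto `T*_y M`. -/
def covectorEquiv (z : M) {y : M} (hy : y ∈ (chartAt (Model d) z).source) :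
    DualModel d ≃L[ℝ] CotangentSpace d M y :=
  ((trivializationAt (DualModel d) (CotangentSpace d M) z).continuousLinearEquivAt ℝ y
    (mem_baseSet_cotangent hy)).symm

theorem covectorEquiv_apply (z : M) {y : M} (hy : y ∈ (chartAt (Model d) z).source)
    (q : DualModel d) : covectorEquiv z hy q = covector z y q := rfl

/-- The pairing of covectors and vectors is the pairing of their coordinates. -/
theorem covector_apply (z : M) {y : M} (hy : y ∈ (chartAt (Model d) z).source) (q : DualModel d)
    (v : TangentSpace (𝓡 d) y) :
    (covector z y q v : ℝ) =
      q ((trivializationAt (Model d) (TangentSpace (𝓡 d)) z).continuousLinearMapAt ℝ y v) := by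
  let e := trivializationAt (DualModel d) (CotangentSpace d M) z
  let eT := trivializationAt (Model d) (TangentSpace (𝓡 d) : M → Type _) z
  have h1 : (e ⟨y, covector z y q⟩).2 = q :=
    congrArg Prod.snd (e.apply_mk_symm (mem_baseSet_cotangent hy) q)
  have h2 : (covector z y q) (eT.symmL ℝ y (eT.continuousLinearMapAt ℝ y v)) =
      q (eT.continuousLinearMapAt ℝ y v) := by
    rw [hom_trivializationAt_apply] at h1
    conv_rhs => rw [← h1]
    rw [ContinuousLinearMap.inCoordinates]
    simp
    rfl
  have hy' : y ∈ eT.baseSet := hy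
  rwa [eT.symmL_continuousLinearMapAt hy'] at h2

end Coordinates

section Lagrangian

variable {d : ℕ} {M : Type*} [TopologicalSpace M] [ChartedSpace (Model d) M]
  [IsManifold (𝓡 d) ∞ M] {H : ℝ → CotangentBundle d M → ℝ}

/-- Superlinearity does not depend on the chart in which the norm of covectors is taken. -/
theorem IsTonelli.superlinear_covector (hH : IsTonelli H) (t : ℝ) (z : M) {y : M}
    (hy : y ∈ (chartAt (Model d) z).source) (c : ℝ) :
    ∃ r : ℝ, ∀ q : DualModel d, r ≤ ‖q‖ → c * ‖q‖ ≤ |H t ⟨y, covector z y q⟩| := by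
  let A : DualModel d ≃L[ℝ] DualModel d := covectorEquiv z hy
  obtain ⟨m, hm, hA⟩ : ∃ m : ℝ, 0 ≤ m ∧ ∀ q, ‖q‖ ≤ m * ‖A q‖ :=
    ⟨_, norm_nonneg _, fun q => by
      simpa using (A.symm : DualModel d →L[ℝ] DualModel d).le_opNorm (A q)⟩
  have h := (hH.superlinear t y).eventually_ge_atTop (|c| * m)
  obtain ⟨r, -, hr⟩ :=
    (Metric.hasBasis_cobounded_compl_closedBall (0 : DualModel d)).eventually_iff.1 h
  refine ⟨m * |r| + 1, fun q hq => ?_⟩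
  have hrq : |r| < ‖A q‖ := by
    by_contra! hle
    have := mul_le_mul_of_nonneg_left hle hm
    linarith [hA q]
  have hq0 : 0 < ‖A q‖ := (abs_nonneg r).trans_lt hrq
  have h1 : |c| * m ≤ |H t ⟨y, A q⟩| / ‖A q‖ := hr (by
    simpa using (le_abs_self r).trans_lt hrq)
  rw [le_div_iff₀ hq0] at h1
  calc c * ‖q‖ ≤ |c| * ‖q‖ := by gcongr; exact le_abs_self c
    _ ≤ |c| * (m * ‖A q‖) := by gcongr; exact hA q
    _ = |c| * m * ‖A q‖ := by ring
    _ ≤ _ := h1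

theorem IsTonelli.continuous (hH : IsTonelli H) :
    Continuous fun w : ℝ × CotangentBundle d M => H w.1 w.2 :=
  hH.contMDiff.continuous

theorem IsTonelli.add_intCast (hH : IsTonelli H) (τ : ℝ) (k : ℤ) (z : CotangentBundle d M) :
    H (τ + k) z = H τ z := by
  have hp : Function.Periodic (fun τ => H τ z) 1 := fun τ => hH.periodic τ z
  simpa using hp.int_mul k τ

theorem IsTonelli.fract (hH : IsTonelli H) (τ : ℝ) (z : CotangentBundle d M) :
    H (Int.fract τ) z = H τ z := by
  rw [← hH.add_intCast (Int.fract τ) ⌊τ⌋, Int.fract_add_floor]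

/-- In a chart, a Tonelli Hamiltonian is superlinear uniformly over compact sets of base points. -/
theorem IsTonelli.exists_superlinear (hH : IsTonelli H) (z : M) {B : Set M} (hB : IsCompact B)
    (hBz : B ⊆ (chartAt (Model d) z).source) {c : ℝ} (hc : 0 ≤ c) :
    ∃ C : ℝ, ∀ (τ : ℝ), ∀ y ∈ B, ∀ q : DualModel d,
      c * ‖q‖ - C ≤ H τ ⟨y, covector z y q⟩ := by
  have : CompactSpace (Set.Icc (0 : ℝ) 1 ×ˢ B : Set (ℝ × M)) :=
    isCompact_iff_compactSpace.1 (isCompact_Icc.prod hB)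
  let h : (Set.Icc (0 : ℝ) 1 ×ˢ B : Set (ℝ × M)) → DualModel d → ℝ :=
    fun ξ q => H ξ.1.1 ⟨ξ.1.2, covector z ξ.1.2 q⟩
  have hcont : Continuous (Function.uncurry h) := by
    have h1 : Continuous fun w : (Set.Icc (0 : ℝ) 1 ×ˢ B : Set (ℝ × M)) × DualModel d =>
        (⟨w.1.1.2, covector z w.1.1.2 w.2⟩ : CotangentBundle d M) :=
      (continuousOn_covector z).comp_continuous
        (f := fun w : (Set.Icc (0 : ℝ) 1 ×ˢ B : Set (ℝ × M)) × DualModel d => (w.1.1.2, w.2))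
        (by fun_prop) fun w => ⟨hBz w.1.2.2, trivial⟩
    have h2 : Continuous fun w : (Set.Icc (0 : ℝ) 1 ×ˢ B : Set (ℝ × M)) × DualModel d =>
      w.1.1.1 := by fun_prop
    exact hH.continuous.comp (h2.prodMk h1)
  have hconv : ∀ ξ, ConvexOn ℝ Set.univ (h ξ) := fun ξ =>
    (hH.convexOn_fibre ξ.1.1 ξ.1.2).comp_linearMap
      (covectorEquiv z (hBz ξ.2.2)).toLinearEquiv.toLinearMap
  obtain ⟨C, hC⟩ := exists_uniform_superlinear hcont hconv
    (fun ξ => hH.superlinear_covector ξ.1.1 z (hBz ξ.2.2)) hc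
  refine ⟨C, fun τ y hy q => ?_⟩
  rw [← hH.fract]
  exact hC ⟨(Int.fract τ, y), ⟨Int.fract_nonneg τ, (Int.fract_lt_one τ).le⟩, hy⟩ q

/-- The Lagrangian in a chart: covectors and vectors are replaced by their coordinates. -/
theorem lagrangian_eq_iSup (τ : ℝ) (z : M) {y : M} (hy : y ∈ (chartAt (Model d) z).source)
    (v : TangentSpace (𝓡 d) y) :
    lagrangian H τ y v = ⨆ q : DualModel d,
      (q ((trivializationAt (Model d) (TangentSpace (𝓡 d)) z).continuousLinearMapAt ℝ y v) -
        H τ ⟨y, covector z y q⟩) := by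
  refine ((covectorEquiv z hy).toEquiv.iSup_congr fun q => ?_).symm
  rw [← covector_apply z hy]
  rfl

/-- The Legendre transform is finite, uniformly for bounded velocities over compact sets. -/
theorem IsTonelli.exists_lagrangian_bound (hH : IsTonelli H) (z : M) {B : Set M} (hB : IsCompact B)
    (hBz : B ⊆ (chartAt (Model d) z).source) {c : ℝ} (hc : 0 ≤ c) :
    ∃ C : ℝ, ∀ (τ : ℝ), ∀ y ∈ B, ∀ v : Model d, ‖v‖ ≤ c → ∀ q : DualModel d,
      q v - H τ ⟨y, covector z y q⟩ ≤ C := by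
  obtain ⟨C, hC⟩ := hH.exists_superlinear z hB hBz hc
  refine ⟨C, fun τ y hy v hv q => ?_⟩
  have h1 := hC τ y hy q
  have h2 : q v ≤ ‖q‖ * c := ((le_abs_self _).trans (q.le_opNorm v)).trans (by gcongr)
  linarith

theorem IsTonelli.bddAbove_lagrangian (hH : IsTonelli H) (τ : ℝ) (y : M)
    (v : TangentSpace (𝓡 d) y) :
    BddAbove (Set.range fun p : CotangentSpace d M y => (p v : ℝ) - H τ ⟨y, p⟩) := by
  have hy := mem_chart_source (Model d) y
  obtain ⟨C, hC⟩ := hH.exists_lagrangian_bound y isCompact_singleton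
    (Set.singleton_subset_iff.2 hy) (norm_nonneg
      ((trivializationAt (Model d) (TangentSpace (𝓡 d)) y).continuousLinearMapAt ℝ y v))
  refine ⟨C, ?_⟩
  rintro _ ⟨p, rfl⟩
  obtain ⟨q, rfl⟩ := (covectorEquiv y hy).surjective p
  have := hC τ y rfl _ le_rfl q
  rwa [← covector_apply y hy] at this

/-- The Lagrangian is bounded below, by minus the maximum of the Hamiltonian on the zero section. -/
theorem IsTonelli.exists_le_lagrangian [CompactSpace M] (hH : IsTonelli H) :
    ∃ K : ℝ, 0 ≤ K ∧ ∀ (τ : ℝ) (y : M) (v : TangentSpace (𝓡 d) y), -K ≤ lagrangian H τ y v := by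
  have hz : Continuous fun y : M => (⟨y, 0⟩ : CotangentBundle d M) :=
    (Bundle.contMDiff_zeroSection (IB := 𝓡 d) (n := 0) ℝ (CotangentSpace d M)
      (F := DualModel d)).continuous
  have hc : Continuous fun w : ℝ × M => H w.1 ⟨w.2, 0⟩ :=
    hH.continuous.comp (continuous_fst.prodMk (hz.comp continuous_snd))
  obtain ⟨K, hK⟩ := ((isCompact_Icc (a := (0 : ℝ)) (b := 1)).prod
    (isCompact_univ (X := M))).exists_bound_of_continuousOn hc.continuousOn
  refine ⟨|K|, abs_nonneg K, fun τ y v => ?_⟩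
  have h1 := (abs_le.1 (hK (Int.fract τ, y)
    ⟨⟨Int.fract_nonneg τ, (Int.fract_lt_one τ).le⟩, trivial⟩)).2
  dsimp only at h1
  rw [hH.fract] at h1
  have h2 := le_ciSup (hH.bddAbove_lagrangian τ y v) 0
  have h3 : ((0 : CotangentSpace d M y) v : ℝ) = 0 := rfl
  simp only [h3] at h2
  have h4 := le_abs_self K
  unfold lagrangian
  linarith

end Lagrangian

/-! ### Connecting points with bounded action -/

section Connect

variable {d : ℕ} {M : Type*} [TopologicalSpace M] [ChartedSpace (Model d) M]
  [IsManifold (𝓡 d) ∞ M] {H : ℝ → CotangentBundle d M → ℝ}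

/-- A curve that is smooth on `[s, t]` is absolutely continuous. -/
theorem _root_.ContMDiffOn.isACCurve {γ : ℝ → M} {s t : ℝ}
    (hγ : ContMDiffOn 𝓘(ℝ, ℝ) (𝓡 d) 1 γ (Set.Icc s t)) : IsACCurve d γ s t := by
  refine ⟨hγ.continuousOn, fun x a b ha hab hb hmem => ?_⟩
  apply ContDiffOn.absolutelyContinuousOnInterval
  rw [Set.uIcc_of_le hab, ← contMDiffOn_iff_contDiffOn]
  exact (contMDiffOn_extChartAt (n := 1)).comp (hγ.mono (Set.Icc_subset_Icc ha hb)) hmem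

/-- The velocity of a curve that is the affine curve `a + (τ - s) v` in the chart at `z`. -/
theorem continuousLinearMapAt_velocity {z : M} {γ : ℝ → M} {a v : Model d} {s τ : ℝ}
    (hmem : a + (τ - s) • v ∈ (extChartAt (𝓡 d) z).target)
    (hγ : γ =ᶠ[𝓝 τ] fun σ => (extChartAt (𝓡 d) z).symm (a + (σ - s) • v)) :
    (trivializationAt (Model d) (TangentSpace (𝓡 d)) z).continuousLinearMapAt ℝ (γ τ)
      (velocity d γ τ) = v := by
  have hτ : γ τ = (extChartAt (𝓡 d) z).symm (a + (τ - s) • v) := hγ.self_of_nhds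
  have hsrc : γ τ ∈ (chartAt (Model d) z).source := by
    rw [hτ, ← extChartAt_source (𝓡 d)]
    exact (extChartAt (𝓡 d) z).map_target hmem
  have hline : HasDerivAt (fun σ : ℝ => a + (σ - s) • v) v τ := by
    simpa using (((hasDerivAt_id τ).sub_const s).smul_const v).const_add a
  have htgt : (extChartAt (𝓡 d) z).target ∈ 𝓝 (a + (τ - s) • v) :=
    (isOpen_extChartAt_target z).mem_nhds hmem
  have hdiff : MDifferentiableAt 𝓘(ℝ, ℝ) (𝓡 d) γ τ := by
    have h1 : MDifferentiableAt 𝓘(ℝ, Model d) (𝓡 d) (extChartAt (𝓡 d) z).symm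
        (a + (τ - s) • v) :=
      ((contMDiffOn_extChartAt_symm (I := 𝓡 d) (n := 1) z).contMDiffAt htgt).mdifferentiableAt
        one_ne_zero
    exact (h1.comp τ hline.differentiableAt.mdifferentiableAt).congr_of_eventuallyEq hγ
  have hchart : MDifferentiableAt (𝓡 d) 𝓘(ℝ, Model d) (extChartAt (𝓡 d) z) (γ τ) :=
    mdifferentiableAt_extChartAt hsrc
  have hcomp := mfderiv_comp τ hchart hdiff
  have heq : extChartAt (𝓡 d) z ∘ γ =ᶠ[𝓝 τ] fun σ : ℝ => a + (σ - s) • v := by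
    filter_upwards [hγ, hline.continuousAt.preimage_mem_nhds htgt] with σ h1 h2
    rw [Function.comp_apply, h1]
    exact (extChartAt (𝓡 d) z).right_inv h2
  rw [heq.mfderiv_eq, mfderiv_eq_fderiv] at hcomp
  rw [TangentBundle.continuousLinearMapAt_trivializationAt hsrc]
  have h2 := congrArg (fun A : ℝ →L[ℝ] Model d => A 1) hcomp
  refine (h2.symm.trans ?_)
  exact (congrArg (fun A : ℝ →L[ℝ] Model d => A 1) hline.hasFDerivAt.fderiv).trans (by simp)

/-- Points of a small chart ball are joined by segments in the chart; the action of these is bounded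
because their speed is. -/
theorem IsTonelli.exists_nhds_reach [CompactSpace M] (hH : IsTonelli H) (z : M) :
    ∃ U ∈ 𝓝 z, ∀ δ > 0, ∃ K : ℝ, ∀ x ∈ U, ∀ y ∈ U, ∀ s : ℝ,
      ∃ a ≤ K, Reach H s (s + δ) x y a := by
  let φ := extChartAt (𝓡 d) z
  have htgt : φ.target ∈ 𝓝 (φ z) := (isOpen_extChartAt_target z).mem_nhds (mem_extChartAt_target z)
  obtain ⟨ρ, hρ, hball⟩ := Metric.nhds_basis_closedBall.mem_iff.1 htgt
  let B : Set M := φ.symm '' Metric.closedBall (φ z) ρ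
  have hB : IsCompact B := (isCompact_closedBall _ _).image_of_continuousOn
    ((continuousOn_extChartAt_symm z).mono hball)
  have hBz : B ⊆ (chartAt (Model d) z).source := by
    rintro _ ⟨q, hq, rfl⟩
    rw [← extChartAt_source (𝓡 d)]
    exact φ.map_target (hball hq)
  refine ⟨φ.source ∩ φ ⁻¹' Metric.closedBall (φ z) ρ, Filter.inter_mem
    (extChartAt_source_mem_nhds z)
    ((continuousAt_extChartAt z).preimage_mem_nhds (Metric.closedBall_mem_nhds _ hρ)),
    fun δ hδ => ?_⟩
  obtain ⟨C, hC⟩ := hH.exists_lagrangian_bound z hB hBz (c := 2 * ρ / δ) (by positivity)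
  obtain ⟨K, hK, hlow⟩ := hH.exists_le_lagrangian
  refine ⟨C * δ, fun x hx y hy s => ?_⟩
  set v : Model d := δ⁻¹ • (φ y - φ x) with hv
  have hδv : δ • v = φ y - φ x := by rw [hv, smul_smul, mul_inv_cancel₀ hδ.ne', one_smul]
  have hvnorm : ‖v‖ ≤ 2 * ρ / δ := by
    have h1 : ‖φ y - φ x‖ ≤ 2 * ρ := by
      have h2 := dist_triangle_right (φ y) (φ x) (φ z)
      have h3 := Metric.mem_closedBall.1 hx.2
      have h4 := Metric.mem_closedBall.1 hy.2
      rw [dist_eq_norm] at h2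
      linarith
    rw [hv, norm_smul, norm_inv, Real.norm_of_nonneg hδ.le, inv_mul_eq_div]
    gcongr
  let line : ℝ → Model d := fun τ => φ x + (τ - s) • v
  have hline : ∀ τ ∈ Set.Icc s (s + δ), line τ ∈ Metric.closedBall (φ z) ρ := by
    intro τ hτ
    have h1 : line τ = φ x + ((τ - s) / δ) • (φ y - φ x) := by
      simp only [line, ← hδv, smul_smul, div_mul_cancel₀ _ hδ.ne']
    rw [h1]
    exact (convex_closedBall (φ z) ρ).add_smul_sub_mem hx.2 hy.2
      ⟨div_nonneg (by linarith [hτ.1]) hδ.le, (div_le_one hδ).2 (by linarith [hτ.2])⟩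
  -- the time is clamped to `[s, s + δ]`, so that the curve stays in the chart for all times
  let clamp : ℝ → ℝ := fun τ => max s (min τ (s + δ))
  have hclamp : ∀ τ, clamp τ ∈ Set.Icc s (s + δ) := fun τ =>
    ⟨le_max_left _ _, max_le (by linarith) (min_le_right _ _)⟩
  have hclamp' : ∀ τ ∈ Set.Icc s (s + δ), clamp τ = τ := fun τ hτ => by
    simp only [clamp, min_eq_left hτ.2, max_eq_right hτ.1]
  let γ : ℝ → M := fun τ => φ.symm (line (clamp τ))
  have hγB : ∀ τ, γ τ ∈ B := fun τ => Set.mem_image_of_mem _ (hline _ (hclamp τ))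
  have hlinec : Continuous line := by fun_prop
  have hγc : Continuous γ := (continuousOn_extChartAt_symm z).comp_continuous
    (by fun_prop) fun τ => hball (hline _ (hclamp τ))
  have hγline : Set.EqOn (fun τ => φ.symm (line τ)) γ (Set.Icc s (s + δ)) := fun τ hτ => by
    simp only [γ, hclamp' τ hτ]
  have hac : IsACCurve d γ s (s + δ) := by
    refine IsACCurve.congr ?_ hγline
    apply ContMDiffOn.isACCurve
    have h1 : ContMDiff 𝓘(ℝ, ℝ) 𝓘(ℝ, Model d) 1 line :=
      contMDiff_iff_contDiff.2 (by fun_prop)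
    exact (contMDiffOn_extChartAt_symm z).comp h1.contMDiffOn fun τ hτ => hball (hline τ hτ)
  -- the Lagrangian along the curve, a supremum of continuous functions of time
  let G : ℝ → ℝ := fun τ => ⨆ q : DualModel d, (q v - H τ ⟨γ τ, covector z (γ τ) q⟩)
  have hbdd : ∀ τ, BddAbove (Set.range fun q : DualModel d =>
      q v - H τ ⟨γ τ, covector z (γ τ) q⟩) := fun τ => ⟨C, by
    rintro _ ⟨q, rfl⟩
    exact hC τ _ (hγB τ) v hvnorm q⟩
  have hGm : Measurable G := by
    refine (lowerSemicontinuous_ciSup hbdd fun q => Continuous.lowerSemicontinuous ?_).measurable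
    have h1 : Continuous fun τ => (⟨γ τ, covector z (γ τ) q⟩ : CotangentBundle d M) :=
      (continuousOn_covector z).comp_continuous (f := fun τ => (γ τ, q)) (by fun_prop)
        fun τ => ⟨hBz (hγB τ), trivial⟩
    exact continuous_const.sub (hH.continuous.comp (continuous_id.prodMk h1))
  have hGC : ∀ τ, G τ ≤ C := fun τ => ciSup_le fun q => hC τ _ (hγB τ) v hvnorm q
  have hLG : ∀ τ ∈ Set.Ioo s (s + δ), lagrangianAlong H γ τ = G τ := by
    intro τ hτ
    have h1 := lagrangian_eq_iSup (H := H) τ z (hBz (hγB τ)) (velocity d γ τ)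
    rw [continuousLinearMapAt_velocity (a := φ x) (v := v) (s := s)
      (hball (hline τ (Set.Ioo_subset_Icc_self hτ)))
      ((hγline.symm.mono Set.Ioo_subset_Icc_self).eventuallyEq_of_mem
        (isOpen_Ioo.mem_nhds hτ))] at h1
    exact h1
  have hae : ∀ᵐ τ ∂MeasureTheory.volume, τ ∈ Set.uIoc s (s + δ) →
      lagrangianAlong H γ τ = G τ := by
    have h1 : ∀ᵐ τ ∂(MeasureTheory.volume : MeasureTheory.Measure ℝ), τ ≠ s + δ := by
      simp [MeasureTheory.ae_iff]
    filter_upwards [h1] with τ hτ hmem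
    rw [Set.uIoc_of_le (by linarith)] at hmem
    exact hLG τ ⟨hmem.1, lt_of_le_of_ne hmem.2 hτ⟩
  have hGint : IntervalIntegrable G MeasureTheory.volume s (s + δ) := by
    rw [intervalIntegrable_iff]
    refine MeasureTheory.Measure.integrableOn_of_bounded (M := max C K) (by simp)
      hGm.aestronglyMeasurable ?_
    filter_upwards [(MeasureTheory.ae_restrict_iff' measurableSet_uIoc).2 hae] with τ hτ
    rw [Real.norm_eq_abs, abs_le]
    refine ⟨?_, (hGC τ).trans (le_max_left _ _)⟩
    rw [← hτ]
    linarith [hlow τ (γ τ) (velocity d γ τ), le_max_right C K,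
      show lagrangianAlong H γ τ = lagrangian H τ (γ τ) (velocity d γ τ) from rfl]
  refine ⟨∫ τ in s..(s + δ), lagrangianAlong H γ τ, ?_, γ, hac, ?_, ?_, ?_, rfl⟩
  · rw [intervalIntegral.integral_congr_ae hae]
    have := intervalIntegral.integral_mono_on (by linarith) hGint
      (intervalIntegrable_const (c := C)) fun τ _ => hGC τ
    rw [intervalIntegral.integral_const, smul_eq_mul] at this
    linarith
  · rw [← hγline ⟨le_rfl, by linarith⟩]
    simp only [line, sub_self, zero_smul, add_zero]
    exact φ.left_inv hx.1
  · rw [← hγline ⟨by linarith, le_rfl⟩]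
    simp only [line, add_sub_cancel_left, hδv, add_sub_cancel]
    exact φ.left_inv hy.1
  · exact hGint.congr_ae ((MeasureTheory.ae_restrict_iff' measurableSet_uIoc).2
      (hae.mono fun τ h hτ => (h hτ).symm))

/-- Any two points can be joined in any given time, with an action that is bounded independently of
the initial time. -/
theorem IsTonelli.exists_reach [CompactSpace M] [ConnectedSpace M] (hH : IsTonelli H) (x y : M) :
    ∀ δ > 0, ∃ K : ℝ, ∀ s : ℝ, ∃ a ≤ K, Reach H s (s + δ) x y a := by
  refine PreconnectedSpace.induction₂' (fun x y => ∀ δ > 0, ∃ K : ℝ, ∀ s : ℝ, ∃ a ≤ K,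
    Reach H s (s + δ) x y a) (fun z => ?_) ⟨fun x y w hxy hyw δ hδ => ?_⟩ x y
  · obtain ⟨U, hU, h⟩ := hH.exists_nhds_reach z
    filter_upwards [hU] with y hy
    constructor
    · intro δ hδ
      obtain ⟨K, hK⟩ := h δ hδ
      exact ⟨K, hK z (mem_of_mem_nhds hU) y hy⟩
    · intro δ hδ
      obtain ⟨K, hK⟩ := h δ hδ
      exact ⟨K, hK y hy z (mem_of_mem_nhds hU)⟩
  · obtain ⟨K₁, h₁⟩ := hxy (δ / 2) (half_pos hδ)
    obtain ⟨K₂, h₂⟩ := hyw (δ / 2) (half_pos hδ)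
    refine ⟨K₁ + K₂, fun s => ?_⟩
    obtain ⟨a, ha, hxa⟩ := h₁ s
    obtain ⟨b, hb, hyb⟩ := h₂ (s + δ / 2)
    refine ⟨a + b, add_le_add ha hb, ?_⟩
    have := hxa.concat (by linarith) (by linarith) hyb
    rwa [add_assoc, add_halves] at this

/-- Near a pair `(x, y)`, join `x'` to `x` and `y` to `y'` by short segments; then use compactness
of `M × M`. -/
theorem IsTonelli.exists_reach_uniform [CompactSpace M] [ConnectedSpace M] (hH : IsTonelli H) :
    ∃ K : ℝ, ∀ (s : ℝ) (x y : M), ∃ a ≤ K, Reach H s (s + 1) x y a := by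
  suffices h : ∃ K : ℝ, ∀ w ∈ (Set.univ : Set (M × M)), ∀ s : ℝ,
      ∃ a ≤ K, Reach H s (s + 1) w.1 w.2 a by
    obtain ⟨K, hK⟩ := h
    exact ⟨K, fun s x y => hK (x, y) trivial s⟩
  refine isCompact_univ.induction_on (p := fun S : Set (M × M) => ∃ K : ℝ, ∀ w ∈ S, ∀ s : ℝ,
    ∃ a ≤ K, Reach H s (s + 1) w.1 w.2 a) ⟨0, by simp⟩
    (fun S T hST ⟨K, hK⟩ => ⟨K, fun w hw => hK w (hST hw)⟩) ?_ ?_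
  · rintro S T ⟨K, hK⟩ ⟨K', hK'⟩
    refine ⟨max K K', ?_⟩
    rintro w (hw | hw) s
    · obtain ⟨a, ha, h⟩ := hK w hw s
      exact ⟨a, ha.trans (le_max_left _ _), h⟩
    · obtain ⟨a, ha, h⟩ := hK' w hw s
      exact ⟨a, ha.trans (le_max_right _ _), h⟩
  · rintro ⟨x, y⟩ -
    obtain ⟨U, hU, hx⟩ := hH.exists_nhds_reach x
    obtain ⟨V, hV, hy⟩ := hH.exists_nhds_reach y
    obtain ⟨K₁, h₁⟩ := hx (1 / 4) (by norm_num)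
    obtain ⟨K₂, h₂⟩ := hH.exists_reach x y (1 / 2) (by norm_num)
    obtain ⟨K₃, h₃⟩ := hy (1 / 4) (by norm_num)
    refine ⟨U ×ˢ V, mem_nhdsWithin_of_mem_nhds (prod_mem_nhds hU hV), K₁ + K₂ + K₃, ?_⟩
    rintro ⟨x', y'⟩ ⟨hx', hy'⟩ s
    obtain ⟨a, ha, r₁⟩ := h₁ x' hx' x (mem_of_mem_nhds hU) s
    obtain ⟨b, hb, r₂⟩ := h₂ (s + 1 / 4)
    obtain ⟨c, hc, r₃⟩ := h₃ y (mem_of_mem_nhds hV) y' hy' (s + 1 / 4 + 1 / 2)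
    refine ⟨a + b + c, by linarith, ?_⟩
    have := (r₁.concat (by linarith) (by linarith) r₂).concat (by linarith) (by linarith) r₃
    rwa [show s + 1 / 4 + 1 / 2 + 1 / 4 = s + 1 by ring] at this

end Connect

/-! ### The critical value and the Lax–Oleinik operator -/

section Critical

variable {d : ℕ} {M : Type*} [TopologicalSpace M] [ChartedSpace (Model d) M]
  {H : ℝ → CotangentBundle d M → ℝ}

theorem IsTonelli.exists_isTransitionCost [IsManifold (𝓡 d) ∞ M] [CompactSpace M]
    [ConnectedSpace M] (hH : IsTonelli H) :
    ∃ K : ℝ, 0 ≤ K ∧ IsTransitionCost (Reach H) K := by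
  obtain ⟨K₁, hK₁, hlow⟩ := hH.exists_le_lagrangian
  obtain ⟨K₂, hK₂⟩ := hH.exists_reach_uniform
  have hle := le_max_left K₁ K₂
  refine ⟨max K₁ K₂, hK₁.trans hle, Reach.concat, Reach.split,
    fun k h => h.shift fun τ z => hH.add_intCast τ k z,
    Reach.lower fun τ x v => (neg_le_neg hle).trans (hlow τ x v), fun s x y => ?_⟩
  obtain ⟨a, ha, h⟩ := hK₂ s x y
  exact ⟨a, ha.trans (le_max_right _ _), h⟩

/-- The growth rate of the minimal action is the critical value: adding `c` to the Lagrangian makes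
the potentials tend to `-∞` or to `+∞` according to the sign of `c - α`. -/
theorem maneCriticalValue_eq_of_growth [Nonempty M] {α C : ℝ}
    (hlow : ∀ s t : ℝ, s ≤ t → ∀ x y a, Reach H s t x y a → -α * (t - s) - C ≤ a)
    (hup : ∀ s t : ℝ, s + 1 ≤ t → ∀ x y, ∃ a, Reach H s t x y a ∧ a ≤ -α * (t - s) + C) :
    maneCriticalValue H = α := by
  have hn : ∀ s t : ℝ, Filter.Tendsto (fun n : ℕ => (n : ℝ) + t - s) Filter.atTop Filter.atTop :=
    fun s t => by
      simp only [add_sub_assoc]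
      exact Filter.tendsto_atTop_add_const_right _ _ tendsto_natCast_atTop_atTop
  refine maneCriticalValue_eq H α (fun c hc s t x y => ?_) fun c hc s t x y => ?_
  · have h1 : Filter.Tendsto (fun n : ℕ => (c - α) * (n + t - s) + C) Filter.atTop Filter.atBot :=
      Filter.tendsto_atBot_add_const_right _ _ ((hn s t).const_mul_atTop_of_neg (sub_neg.2 hc))
    refine Filter.Tendsto.liminf_eq (tendsto_of_tendsto_of_tendsto_of_le_of_le' tendsto_const_nhds
      (EReal.tendsto_coe_nhds_bot_iff.2 h1) (Filter.Eventually.of_forall fun _ => bot_le) ?_)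
    filter_upwards [(hn s t).eventually_ge_atTop 1] with n hn1
    obtain ⟨a, ha, hle⟩ := hup s (n + t) (by linarith) x y
    calc potentialAt H c s (n + t) x y ≤ (a : EReal) + ((c * (n + t - s) : ℝ) : EReal) :=
          add_le_add_left (potential_le_of_reach ha) _
      _ ≤ (((c - α) * (n + t - s) + C : ℝ) : EReal) := by
          rw [← EReal.coe_add, EReal.coe_le_coe_iff]
          linarith
  · have h1 : Filter.Tendsto (fun n : ℕ => (c - α) * (n + t - s) + -C) Filter.atTop Filter.atTop :=
      Filter.tendsto_atTop_add_const_right _ _ ((hn s t).const_mul_atTop (sub_pos.2 hc))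
    refine Filter.Tendsto.liminf_eq (tendsto_of_tendsto_of_tendsto_of_le_of_le'
      (EReal.tendsto_coe_nhds_top_iff.2 h1) tendsto_const_nhds ?_
      (Filter.Eventually.of_forall fun _ => le_top))
    filter_upwards [(hn s t).eventually_ge_atTop 0] with n hn0
    calc (((c - α) * (n + t - s) + -C : ℝ) : EReal)
        = ((-α * (n + t - s) - C : ℝ) : EReal) + ((c * (n + t - s) : ℝ) : EReal) := by
          rw [← EReal.coe_add]
          congr 1
          ring
      _ ≤ potentialAt H c s (n + t) x y :=
          add_le_add_left (le_potential fun a ha => hlow s (n + t) (by linarith) x y a ha) _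

end Critical

end WeakKAM
end

theorem propositionA6 (d : ℕ) (M : Type*) [TopologicalSpace M]
    [ChartedSpace (EuclideanSpace ℝ (Fin d)) M] [IsManifold (𝓡 d) ∞ M]
    [T2Space M] [CompactSpace M] [ConnectedSpace M]
    (H : ℝ → WeakKAM.CotangentBundle d M → ℝ) (hH : WeakKAM.IsTonelli H)
    (t : ℝ) (u : C(M, ℝ)) :
    ∃ C : ℝ, ∀ s : ℝ, s < t → ∀ x : M,
      ∃ r : ℝ, WeakKAM.posLaxOleinik H t s u x = (r : EReal) ∧ |r| ≤ C := by
  obtain ⟨K, hK, hR⟩ := hH.exists_isTransitionCost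
  obtain ⟨α, C, h⟩ := hR.exists_linear_growth hK
  have hα : WeakKAM.maneCriticalValue H = α := WeakKAM.maneCriticalValue_eq_of_growth
    (fun s t hst => (h s t hst).1) fun s t hst => (h s t (by linarith)).2.2 hst
  obtain ⟨U, hU⟩ := isCompact_univ.exists_bound_of_continuousOn u.continuous.continuousOn
  have hU' : ∀ y, -U ≤ u y ∧ u y ≤ U := fun y => abs_le.1 (hU y trivial)
  refine ⟨U + C, fun s hst x => ?_⟩
  obtain ⟨hlow, hstart, -⟩ := h s t hst.le
  have hle : WeakKAM.posLaxOleinik H t s u x ≤ ((U + C : ℝ) : EReal) := by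
    rw [WeakKAM.posLaxOleinik, WeakKAM.posLaxOleinikZero_eq, hα,
      show U + C = (U - (-α * (t - s) - C)) - α * (t - s) by ring, EReal.coe_sub _ (α * (t - s)),
      EReal.coe_sub]
    refine EReal.sub_le_sub (iSup_le fun y => EReal.sub_le_sub ?_ ?_) le_rfl
    · exact EReal.coe_le_coe_iff.2 (hU' y).2
    · exact WeakKAM.le_potential (hlow x y)
  have hge : ((-(U + C) : ℝ) : EReal) ≤ WeakKAM.posLaxOleinik H t s u x := by
    obtain ⟨y, a, hxy, ha⟩ := hstart x
    rw [WeakKAM.posLaxOleinik, WeakKAM.posLaxOleinikZero_eq, hα,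
      show -(U + C) = (-U - (-α * (t - s) + C)) - α * (t - s) by ring,
      EReal.coe_sub _ (α * (t - s)), EReal.coe_sub]
    refine EReal.sub_le_sub (le_trans ?_ (le_iSup _ y)) le_rfl
    refine EReal.sub_le_sub (EReal.coe_le_coe_iff.2 (hU' y).1) ?_
    exact (WeakKAM.potential_le_of_reach hxy).trans (EReal.coe_le_coe_iff.2 ha)
  have hcoe : ((WeakKAM.posLaxOleinik H t s u x).toReal : EReal) =
      WeakKAM.posLaxOleinik H t s u x :=
    EReal.coe_toReal (ne_top_of_le_ne_top (EReal.coe_ne_top _) hle)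
      (ne_bot_of_le_ne_bot (EReal.coe_ne_bot _) hge)
  refine ⟨_, hcoe.symm, abs_le.2 ⟨?_, ?_⟩⟩
  · rwa [← EReal.coe_le_coe_iff, hcoe]
  · rwa [← EReal.coe_le_coe_iff, hcoe]
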